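/- Let $n\ge 1$, let $\mathbb F$ be a field, and let $V=\bigoplus_{m\in\mathbb Z/n}V_m$ be a finite-dimensional $\mathbb F$-vector space with a fixed decomposition into subspaces. Put $\xi(V)=(\dim V_m)_{m}$, $K=\prod_m GL(V_m)$, $\widetilde V=\bigcup_m V_m$, and let $\mathcal N$ be the set of nilpotent $x\in\operatorname{End}V$ with $xV_m\subset V_{m+1}$ for all $m$; $K$ acts on $V\times\mathcal N$ by $k\cdot(v,x)=(kv,kxk^{-1})$. **Combinatorial objects.** A *colored partition* is a pair $(\lambda,\epsilon)$ with $\lambda=(\lambda_1\ge\lambda_2\ge\cdots)$ a sequence of nonnegative integers that is eventually $0$, and $\epsilon:\{1,2,\dots\}\to\mathbb Z/n$ a function taking each value infinitely often. Its length is $l(\lambda)=\#\{i:\lambda_i>0\}$, and its signature is $\xi_m(\lambda,\epsilon)=\#\{(i,j): 1\le j\le\lambda_i,\ \epsilon_i+[\lambda_i-j]=m\}$, $m\in\mathbb Z/n$. A *marked colored partition* $(\lambda,\epsilon,\mu)$ has in addition integers $\mu_i\le\lambda_i$. Two (marked) colored partitions are equivalent if one is obtained from the other by a permutation of the rows $i\in\{1,2,\dots\}$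 (with their colors and marks). Let $\mathcal P_n$ and $\mathcal P_n^{\mathrm m}$ be the sets of equivalence classes; $\mathcal P_n\hookrightarrow\mathcal P_n^{\mathrm m}$ via $(\lambda,\epsilon)\mapsto(\lambda,\epsilon,0)$. The operation $\cup$ on $\mathcal P_n^{\mathrm m}$ interlaces the rows of two marked colored partitions and then permutes them so that the lengths are weakly decreasing. **The map $\Psi$.** Suppose $(\lambda,\epsilon,\mu)$ has signature $\xi(\lambda,\epsilon)=\xi(V)$. Choose $x\in\mathcal N$ and a basis $\{v_{i,j}:1\le j\le\lambda_i\}$ of $V$ with $v_{i,j}\in V_{\epsilon_i+[\lambda_i-j]}$, $xv_{i,j}=v_{i,j-1}$ for $j>1$ and $xv_{i,1}=0$. Put $v_{i,j}=0$ for $j\le 0$. Then $\Psi(\lambda,\epsilon,\mu)$ is the $K$-orbit of $\bigl(\sum_{i\le l(\lambda)}v_{i,\mu_i},\,x\bigr)$; it depends only on the class of $(\lambda,\epsilon,\mu)$. **Characteristic colored bipartitions.** Call a marking $\mu\ge 0$ of a colored partition $(\lambda,\epsilon)$ of signature $\xi(V)$ *minimal* if every marking $\delta$ with $0\le\delta_i\le\mu_i$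 for all $i$ and $\Psi(\lambda,\epsilon,\delta)=\Psi(\lambda,\epsilon,\mu)$ equals $\mu$. Deleting from such a $(\lambda,\epsilon,\mu)$ all rows with $\lambda_i>0$ and $\mu_i=0$ gives a marked colored partition $(\alpha,\beta,\gamma)$. If $\beta_i+[\alpha_i-\gamma_i]=\beta_j+[\alpha_j-\gamma_j]$ for all $1\le i<j\le l(\alpha)$, then $(\alpha,\beta,\gamma)$, and any marked colored partition equivalent to it, is called a *characteristic colored bipartition*. **Statement.** The map $((\lambda,\epsilon,\mu),(\alpha,\beta))\mapsto\Psi\bigl((\lambda,\epsilon,\mu)\cup(\alpha,\beta,0)\bigr)$ is a bijection from the set of pairs in $\mathcal P_n^{\mathrm m}\times\mathcal P_n$ such that $\xi(\lambda,\epsilon)+\xi(\alpha,\beta)=\xi(V)$ and $(\lambda,\epsilon,\mu)$ is a characteristic colored bipartition, onto the set $K\backslash(\widetilde V\times\mathcal N)$ of $K$-orbits. Moreover, a marked colored partition $(\lambda,\epsilon,\mu)$ is a characteristic colored bipartition if and only if $\xi(\lambda,\epsilon)\le\xi(V)$ (componentwise), $\mu_i>0$ for $i\le l(\lambda)$, $\mu_i=0$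 for $i>l(\lambda)$, and for all $1\le i<j\le l(\lambda)$: $\epsilon_i+[\lambda_i-\mu_i]=\epsilon_j+[\lambda_j-\mu_j]$, $\mu_i>\mu_j$ and $\lambda_i-\mu_i>\lambda_j-\mu_j$. -/

import Mathlib

/-! ### Colored partitions

Rows are indexed by `ℕ`, starting with row `0`; the columns of a Young diagram start with `1`. -/

/-- An `n`-colored partition: a weakly decreasing sequence `len` of row lengths that reaches `0`,
with a color in `ZMod n` for each row, each color being used by infinitely many rows. -/
structure ColoredPartition (n : ℕ) where
  len : ℕ → ℕ
  color : ℕ → ZMod n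
  antitone_len : Antitone len
  exists_len_eq_zero : ∃ i, len i = 0
  infinite_color : ∀ m : ZMod n, {i | color i = m}.Infinite

/-- A marked colored partition: a colored partition with an integer `mark i ≤ len i` in each row. -/
structure MarkedColoredPartition (n : ℕ) extends ColoredPartition n where
  mark : ℕ → ℤ
  mark_le : ∀ i, mark i ≤ len i

namespace ColoredPartition

variable {n : ℕ}

theorem finite_support (p : ColoredPartition n) : {i | 0 < p.len i}.Finite := by
  obtain ⟨N, hN⟩ := p.exists_len_eq_zero
  refine (Set.finite_lt_nat N).subset fun i hi => ?_
  by_contra h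
  have h1 := p.antitone_len (not_lt.mp h)
  have h2 : 0 < p.len i := hi
  omega

/-- The number of nonzero rows. -/
noncomputable def length (p : ColoredPartition n) : ℕ := {i | 0 < p.len i}.ncard

/-- The boxes `(i, j)` of the Young diagram (row `i`, column `j`). -/
abbrev Box (p : ColoredPartition n) : Type := {b : ℕ × ℕ // 1 ≤ b.2 ∧ b.2 ≤ p.len b.1}

/-- The color of the box `(i, j)` is `ε i + [λ i - j]`. -/
def boxColor (p : ColoredPartition n) (b : p.Box) : ZMod n :=
  p.color b.1.1 + ((p.len b.1.1 - b.1.2 : ℕ) : ZMod n)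

/-- The signature: the number of boxes of each color. -/
noncomputable def signature (p : ColoredPartition n) (m : ZMod n) : ℕ :=
  Nat.card {b : p.Box // p.boxColor b = m}

/-- Equivalence: a permutation of the rows (necessarily between rows of the same length). -/
def RowEquiv (p q : ColoredPartition n) : Prop :=
  ∃ σ : Equiv.Perm ℕ, q.len = p.len ∘ σ ∧ q.color = p.color ∘ σ

instance setoid (n : ℕ) : Setoid (ColoredPartition n) where
  r := RowEquiv
  iseqv :=
    { refl := fun _ => ⟨1, rfl, rfl⟩
      symm := by
        rintro p q ⟨σ, h1, h2⟩
        exact ⟨σ⁻¹, by rw [h1]; ext; simp, by rw [h2]; ext; simp⟩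
      trans := by
        rintro p q r ⟨σ, h1, h2⟩ ⟨τ, h3, h4⟩
        exact ⟨σ * τ, by rw [h3, h1]; rfl, by rw [h4, h2]; rfl⟩ }

/-- A row permutation induces a bijection between the boxes. -/
def boxEquiv {p q : ColoredPartition n} (σ : Equiv.Perm ℕ) (h : q.len = p.len ∘ σ) :
    q.Box ≃ p.Box where
  toFun b := ⟨(σ b.1.1, b.1.2), b.2.1, by have := congrFun h b.1.1 ▸ b.2.2; exact this⟩
  invFun b := ⟨(σ.symm b.1.1, b.1.2), b.2.1, by have := b.2.2; simpa [h] using this⟩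
  left_inv b := by apply Subtype.ext; simp
  right_inv b := by apply Subtype.ext; simp

theorem boxColor_boxEquiv {p q : ColoredPartition n} (σ : Equiv.Perm ℕ) (h : q.len = p.len ∘ σ)
    (hc : q.color = p.color ∘ σ) (b : q.Box) : p.boxColor (boxEquiv σ h b) = q.boxColor b := by
  simp [boxColor, boxEquiv, h, hc]

theorem signature_eq {p q : ColoredPartition n} (h : p.RowEquiv q) :
    p.signature = q.signature := by
  obtain ⟨σ, h1, h2⟩ := h
  funext m
  exact (Nat.card_congr ((boxEquiv σ h1).subtypeEquiv fun b => by
    rw [boxColor_boxEquiv σ h1 h2])).symm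

theorem length_eq {p q : ColoredPartition n} (h : p.RowEquiv q) : p.length = q.length := by
  obtain ⟨σ, h1, -⟩ := h
  refine (Set.ncard_congr (fun a _ => σ a) ?_ ?_ ?_).symm
  · intro a ha
    simpa [h1] using ha
  · intro a b _ _ hab
    exact σ.injective hab
  · intro b hb
    exact ⟨σ.symm b, by simpa [h1] using hb, by simp⟩

theorem lt_length_iff (p : ColoredPartition n) (i : ℕ) : i < p.length ↔ 0 < p.len i := by
  classical
  have key : ∃ N, {i | 0 < p.len i} = Set.Iio N := by
    refine ⟨Nat.find p.exists_len_eq_zero, ?_⟩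
    ext k
    simp only [Set.mem_ofPred_eq, Set.mem_Iio, Nat.lt_find_iff]
    constructor
    · intro hk m hm h0
      have := p.antitone_len hm
      omega
    · intro hk
      have := hk k le_rfl
      omega
  obtain ⟨N, hN⟩ := key
  have hl : p.length = N := by
    rw [length, hN, ← Finset.coe_Iio, Set.ncard_coe_finset, Nat.card_Iio]
  rw [hl]
  have : i ∈ {i | 0 < p.len i} ↔ i ∈ Set.Iio N := by rw [hN]
  exact this.symm

end ColoredPartition

/-- The set `P_n` of equivalence classes of `n`-colored partitions. -/
def ColoredPartitionClass (n : ℕ) : Type := Quotient (ColoredPartition.setoid n)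

/-- The signature of a class of colored partitions. -/
noncomputable def ColoredPartitionClass.signature {n : ℕ} (c : ColoredPartitionClass n) :
    ZMod n → ℕ :=
  Quotient.lift ColoredPartition.signature (fun _ _ h => ColoredPartition.signature_eq h) c

/-! ### Interlacing, sorting and deleting rows -/

/-- Interlace two sequences, starting with `g 0, f 0, g 1, f 1, …`. -/
def interlace {α : Type*} (f g : ℕ → α) (k : ℕ) : α :=
  if Even k then g (k / 2) else f (k / 2)

theorem interlace_eq {α : Type*} (f g : ℕ → α) :
    interlace f g = Sum.elim g f ∘ Equiv.natSumNatEquivNat.symm := by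
  rw [Equiv.eq_comp_symm]
  funext s
  rcases s with a | a
  · simp [interlace]
  · have h : (2 * a + 1) / 2 = a := by omega
    simp [interlace, h]

theorem exists_perm_antitone (f : ℕ → ℕ) (hf : ∃ N, ∀ i, N ≤ i → f i = 0) :
    ∃ σ : Equiv.Perm ℕ, Antitone (f ∘ σ) := by
  obtain ⟨N, hN⟩ := hf
  let g : Fin N → ℕᵒᵈ := fun i => OrderDual.toDual (f i)
  let e : Fin N ≃ {i : ℕ // i < N} := Fin.equivSubtype
  let σ : Equiv.Perm ℕ := (Tuple.sort g).extendDomain e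
  have hlt : ∀ i (h : i < N), σ i = (Tuple.sort g ⟨i, h⟩ : ℕ) := by
    intro i h
    exact Equiv.Perm.extendDomain_apply_subtype (Tuple.sort g) e h
  have hge : ∀ i, N ≤ i → σ i = i := by
    intro i h
    exact Equiv.Perm.extendDomain_apply_not_subtype (Tuple.sort g) e (not_lt.mpr h)
  refine ⟨σ, fun i j hij => ?_⟩
  by_cases hj : j < N
  · have hi : i < N := lt_of_le_of_lt hij hj
    have := Tuple.monotone_sort g (show (⟨i, hi⟩ : Fin N) ≤ ⟨j, hj⟩ from hij)
    simp only [Function.comp_apply, hlt i hi, hlt j hj]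
    exact this
  · simp only [Function.comp_apply]
    rw [hge j (not_lt.mp hj), hN j (not_lt.mp hj)]
    exact Nat.zero_le _

theorem infinite_preimage_perm {α : Type*} {c : ℕ → α} {m : α} (h : {i | c i = m}.Infinite)
    (σ : Equiv.Perm ℕ) : {i | (c ∘ σ) i = m}.Infinite := by
  intro hfin
  refine h ((hfin.image σ).subset fun i hi => ⟨σ.symm i, ?_, by simp⟩)
  simpa using hi

theorem infinite_interlace {α : Type*} {c d : ℕ → α} {m : α} (h : {i | c i = m}.Infinite) :
    {i | interlace c d i = m}.Infinite := by
  refine (h.image (f := fun i => 2 * i + 1) (fun a _ b _ hab => by simpa using hab)).mono ?_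
  rintro _ ⟨i, hi, rfl⟩
  have h2 : (2 * i + 1) / 2 = i := by omega
  simpa [interlace, h2] using hi

namespace MarkedColoredPartition

variable {n : ℕ}

/-- Row-equivalence: a permutation of the rows together with their marks. -/
def RowEquiv (p q : MarkedColoredPartition n) : Prop :=
  ∃ σ : Equiv.Perm ℕ, q.len = p.len ∘ σ ∧ q.color = p.color ∘ σ ∧ q.mark = p.mark ∘ σ

instance setoid (n : ℕ) : Setoid (MarkedColoredPartition n) where
  r := RowEquiv
  iseqv :=
    { refl := fun _ => ⟨1, rfl, rfl, rfl⟩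
      symm := by
        rintro p q ⟨σ, h1, h2, h3⟩
        exact ⟨σ⁻¹, by rw [h1]; ext; simp, by rw [h2]; ext; simp, by rw [h3]; ext; simp⟩
      trans := by
        rintro p q r ⟨σ, h1, h2, h3⟩ ⟨τ, h4, h5, h6⟩
        exact ⟨σ * τ, by rw [h4, h1]; rfl, by rw [h5, h2]; rfl, by rw [h6, h3]; rfl⟩ }

theorem RowEquiv.shape {p q : MarkedColoredPartition n} (h : p.RowEquiv q) :
    p.toColoredPartition.RowEquiv q.toColoredPartition := by
  obtain ⟨σ, h1, h2, -⟩ := h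
  exact ⟨σ, h1, h2⟩

theorem exists_sort_interlace (p q : MarkedColoredPartition n) :
    ∃ σ : Equiv.Perm ℕ, Antitone (interlace p.len q.len ∘ σ) := by
  obtain ⟨M, hM⟩ := p.exists_len_eq_zero
  obtain ⟨N, hN⟩ := q.exists_len_eq_zero
  refine exists_perm_antitone _ ⟨2 * (M + N), fun i hi => ?_⟩
  have h1 := p.antitone_len (show M ≤ i / 2 by omega)
  have h2 := q.antitone_len (show N ≤ i / 2 by omega)
  unfold interlace
  split <;> omega

/-- Interlace the rows of two marked colored partitions, then permute them so that the lengths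
decrease. -/
noncomputable def union (p q : MarkedColoredPartition n) : MarkedColoredPartition n where
  len := interlace p.len q.len ∘ (exists_sort_interlace p q).choose
  color := interlace p.color q.color ∘ (exists_sort_interlace p q).choose
  mark := interlace p.mark q.mark ∘ (exists_sort_interlace p q).choose
  antitone_len := (exists_sort_interlace p q).choose_spec
  exists_len_eq_zero := by
    obtain ⟨M, hM⟩ := p.exists_len_eq_zero
    refine ⟨(exists_sort_interlace p q).choose.symm (2 * M + 1), ?_⟩
    have h2 : (2 * M + 1) / 2 = M := by omega
    simp [interlace, h2, hM]
  infinite_color := fun m =>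
    infinite_preimage_perm (infinite_interlace (p.infinite_color m)) _
  mark_le := by
    intro i
    simp only [Function.comp_apply, interlace]
    split
    · exact q.mark_le _
    · exact p.mark_le _

theorem union_rowEquiv {p p' q q' : MarkedColoredPartition n} (hp : p.RowEquiv p')
    (hq : q.RowEquiv q') : (p.union q).RowEquiv (p'.union q') := by
  obtain ⟨σ, h1, h2, h3⟩ := hp
  obtain ⟨τ, h4, h5, h6⟩ := hq
  let ρ : Equiv.Perm ℕ :=
    (Equiv.natSumNatEquivNat.symm.trans (Equiv.sumCongr τ σ)).trans Equiv.natSumNatEquivNat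
  have key : ∀ {α : Type} (f g : ℕ → α),
      interlace (f ∘ σ) (g ∘ τ) = interlace f g ∘ ρ := by
    intro α f g
    rw [interlace_eq, interlace_eq]
    funext k
    simp only [ρ, Function.comp_apply, Equiv.trans_apply, Equiv.symm_apply_apply]
    rcases Equiv.natSumNatEquivNat.symm k with a | a <;> simp
  let s := (exists_sort_interlace p q).choose
  let s' := (exists_sort_interlace p' q').choose
  refine ⟨s'.trans (ρ.trans s.symm), ?_, ?_, ?_⟩
  · change interlace p'.len q'.len ∘ s' = _
    rw [h1, h4, key]
    funext k
    simp [union, s]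
  · change interlace p'.color q'.color ∘ s' = _
    rw [h2, h5, key]
    funext k
    simp [union, s]
  · change interlace p'.mark q'.mark ∘ s' = _
    rw [h3, h6, key]
    funext k
    simp [union, s]

/-- Delete the rows indexed by the finite set `S`; `Nat.nth (· ∉ S)` is the increasing enumeration
of the remaining rows. -/
noncomputable def deleteRows (p : MarkedColoredPartition n) (S : Set ℕ) (hS : S.Finite) :
    MarkedColoredPartition n where
  len := p.len ∘ Nat.nth (· ∉ S)
  color := p.color ∘ Nat.nth (· ∉ S)
  mark := p.mark ∘ Nat.nth (· ∉ S)
  antitone_len := p.antitone_len.comp_monotone (Nat.nth_strictMono hS.infinite_compl).monotone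
  exists_len_eq_zero := by
    obtain ⟨N, hN⟩ := p.exists_len_eq_zero
    refine ⟨N, ?_⟩
    have := p.antitone_len ((Nat.nth_strictMono (p := (· ∉ S)) hS.infinite_compl).le_apply (x := N))
    simp only [Function.comp_apply]
    omega
  infinite_color := by
    intro m hfin
    refine ((p.infinite_color m).sdiff hS) ((hfin.image (Nat.nth (· ∉ S))).subset ?_)
    rintro i ⟨hi, hiS⟩
    have hr : i ∈ Set.range (Nat.nth (· ∉ S)) := by
      rw [Nat.range_nth_of_infinite (p := (· ∉ S)) hS.infinite_compl]
      exact hiS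
    obtain ⟨k, rfl⟩ := hr
    exact ⟨k, hi, rfl⟩
  mark_le := fun i => p.mark_le _

/-- The result of deleting the nonzero rows whose mark is `0`. -/
noncomputable def deleteUnmarked (p : MarkedColoredPartition n) : MarkedColoredPartition n :=
  p.deleteRows {i | 0 < p.len i ∧ p.mark i = 0} (p.finite_support.subset fun _ hi => hi.1)

/-- The same colored partition with a new marking. -/
def withMark (p : MarkedColoredPartition n) (δ : ℕ → ℤ) (h : ∀ i, δ i ≤ p.len i) :
    MarkedColoredPartition n where
  toColoredPartition := p.toColoredPartition
  mark := δ
  mark_le := h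

/-- The color `ε i + [λ i - μ i]` attached to the mark in row `i`. -/
def markColor (p : MarkedColoredPartition n) (i : ℕ) : ZMod n :=
  p.color i + ((p.len i - p.mark i : ℤ) : ZMod n)

end MarkedColoredPartition

/-- The set of row-equivalence classes of marked `n`-colored partitions. -/
def MarkedColoredPartitionClass (n : ℕ) : Type := Quotient (MarkedColoredPartition.setoid n)

namespace MarkedColoredPartitionClass

variable {n : ℕ}

/-- The class of a marked colored partition. -/
def mk (p : MarkedColoredPartition n) : MarkedColoredPartitionClass n := Quotient.mk _ p

/-- The signature of a class of marked colored partitions. -/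
noncomputable def signature (c : MarkedColoredPartitionClass n) : ZMod n → ℕ :=
  Quotient.lift (fun p : MarkedColoredPartition n => p.toColoredPartition.signature)
    (fun _ _ h => ColoredPartition.signature_eq (MarkedColoredPartition.RowEquiv.shape h)) c

/-- The operation `∪` on classes of marked colored partitions. -/
noncomputable def union (c d : MarkedColoredPartitionClass n) : MarkedColoredPartitionClass n :=
  Quotient.map₂ MarkedColoredPartition.union
    (fun _ _ hp _ _ hq => MarkedColoredPartition.union_rowEquiv hp hq) c d

end MarkedColoredPartitionClass

/-- The embedding `(λ, ε) ↦ (λ, ε, 0)`. -/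
def ColoredPartitionClass.toMarked {n : ℕ} (c : ColoredPartitionClass n) :
    MarkedColoredPartitionClass n :=
  Quotient.map (fun p : ColoredPartition n => (⟨p, 0, fun _ => by simp⟩ : MarkedColoredPartition n))
    (fun p q (h : p.RowEquiv q) => by
      obtain ⟨σ, h1, h2⟩ := h
      exact ⟨σ, h1, h2, rfl⟩) c

/-! ### Colored vector spaces and enhanced orbits

A colored vector space is a finite-dimensional space `W` with subspaces `V m`, `m : ZMod n`, of
which it is the internal direct sum. -/

section Orbits

variable {n : ℕ} {F W : Type*} [Field F] [AddCommGroup W] [Module F W]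

/-- The signature `m ↦ dim V m` of the colored vector space. -/
noncomputable def spaceSignature (V : ZMod n → Submodule F W) (m : ZMod n) : ℕ :=
  Module.finrank F (V m)

/-- The group `K = ∏ GL(V m)`, as the group of automorphisms of `W` that preserve each `V m`. -/
def colorGroup (V : ZMod n → Submodule F W) : Subgroup (W ≃ₗ[F] W) where
  carrier := {k | ∀ m, (V m).map (k : W →ₗ[F] W) = V m}
  one_mem' := fun m => Submodule.map_id _
  mul_mem' := by
    intro a b ha hb m
    have : ((a * b : W ≃ₗ[F] W) : W →ₗ[F] W) = (a : W →ₗ[F] W).comp (b : W →ₗ[F] W) := rfl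
    rw [this, Submodule.map_comp, hb m, ha m]
  inv_mem' := by
    intro a ha m
    conv_lhs => rw [← ha m]
    rw [← Submodule.map_comp]
    have : ((a⁻¹ : W ≃ₗ[F] W) : W →ₗ[F] W).comp (a : W →ₗ[F] W) = LinearMap.id := by
      ext w
      exact a.symm_apply_apply w
    rw [this, Submodule.map_id]

/-- The colored nilpotent cone: nilpotent endomorphisms that map each `V m` into `V (m + 1)`. -/
def nilpotentCone (V : ZMod n → Submodule F W) : Set (Module.End F W) :=
  {x | IsNilpotent x ∧ ∀ m, ∀ v ∈ V m, x v ∈ V (m + 1)}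

/-- The `K`-orbit of `(v, x)`, where `k` acts by `k • (v, x) = (k v, k x k⁻¹)`. -/
def enhancedOrbit (V : ZMod n → Submodule F W) (p : W × Module.End F W) :
    Set (W × Module.End F W) :=
  {q | ∃ k ∈ colorGroup V, q = (k p.1, k.conj p.2)}

/-- The set of `K`-orbits in `Ṽ × N`, where `Ṽ` is the union of the `V m` and `N` is the colored
nilpotent cone. -/
def enhancedOrbits (V : ZMod n → Submodule F W) : Set (Set (W × Module.End F W)) :=
  {O | ∃ v x, (∃ m, v ∈ V m) ∧ x ∈ nilpotentCone V ∧ O = enhancedOrbit V (v, x)}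

/-- The vector `v_{i,j}` of a basis indexed by the boxes of a Young diagram, extended by `0`. -/
noncomputable def basisEntry {p : ColoredPartition n} (B : Module.Basis p.Box F W) (i : ℕ) (j : ℤ) :
    W :=
  if h : 1 ≤ j ∧ j ≤ p.len i then B ⟨(i, j.toNat), by dsimp only; omega, by dsimp only; omega⟩
  else 0

/-- `B` is a colored Jordan basis for `x`, of type `p`: each `v_{i,j}` lies in the subspace whose
color is that of the box `(i, j)`, and `x v_{i,j} = v_{i,j-1}`, where `v_{i,0} = 0`. -/
def IsColoredJordanBasis (V : ZMod n → Submodule F W) (x : Module.End F W) {p : ColoredPartition n}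
    (B : Module.Basis p.Box F W) : Prop :=
  (∀ b, B b ∈ V (p.boxColor b)) ∧ ∀ b, x (B b) = basisEntry B b.1.1 ((b.1.2 : ℤ) - 1)

/-- The orbit `Ψ(λ, ε, μ)`: the orbit of `(∑ i, v_{i, μ i}, x)`, for any colored Jordan basis
`v_{i,j}` of type `(λ, ε)` of any `x` in the colored nilpotent cone. -/
def Psi (V : ZMod n → Submodule F W) (p : MarkedColoredPartition n) :
    Set (W × Module.End F W) :=
  {q | ∃ x ∈ nilpotentCone V, ∃ B : Module.Basis p.toColoredPartition.Box F W,
    IsColoredJordanBasis V x B ∧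
      q ∈ enhancedOrbit V (∑ i ∈ Finset.range p.length, basisEntry B i (p.mark i), x)}

theorem basisEntry_reindex {p q : ColoredPartition n} (σ : Equiv.Perm ℕ)
    (h : q.len = p.len ∘ σ) (B : Module.Basis p.Box F W) (i : ℕ) (j : ℤ) :
    basisEntry (B.reindex (ColoredPartition.boxEquiv σ h).symm) i j = basisEntry B (σ i) j := by
  have hi : q.len i = p.len (σ i) := congrFun h i
  unfold basisEntry
  by_cases hj : 1 ≤ j ∧ j ≤ p.len (σ i)
  · rw [dif_pos hj, dif_pos (by rw [hi]; exact hj), Module.Basis.reindex_apply]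
    rfl
  · rw [dif_neg hj, dif_neg (by rw [hi]; exact hj)]

theorem Psi_subset (V : ZMod n → Submodule F W) {p q : MarkedColoredPartition n}
    (h : p.RowEquiv q) : Psi V p ⊆ Psi V q := by
  have hl : p.length = q.length := ColoredPartition.length_eq h.shape
  obtain ⟨σ, h1, h2, h3⟩ := h
  rintro y ⟨x, hx, B, ⟨hB1, hB2⟩, hy⟩
  refine ⟨x, hx, B.reindex (ColoredPartition.boxEquiv σ h1).symm, ⟨fun b => ?_, fun b => ?_⟩, ?_⟩
  · rw [Module.Basis.reindex_apply, ← ColoredPartition.boxColor_boxEquiv σ h1 h2 b]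
    exact hB1 _
  · rw [basisEntry_reindex, Module.Basis.reindex_apply]
    exact hB2 _
  · have hsum : ∑ i ∈ Finset.range p.length, basisEntry B i (p.mark i) =
        ∑ i ∈ Finset.range q.length,
          basisEntry (B.reindex (ColoredPartition.boxEquiv σ h1).symm) i (q.mark i) := by
      symm
      refine Finset.sum_equiv σ (fun i => ?_) (fun i _ => ?_)
      · rw [Finset.mem_range, Finset.mem_range, ColoredPartition.lt_length_iff,
          ColoredPartition.lt_length_iff, h1]
        rfl
      · rw [basisEntry_reindex, h3]
        rfl
    rwa [← hsum]

/-- The orbit `Ψ` of a class of marked colored partitions. -/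
def PsiClass (V : ZMod n → Submodule F W) (c : MarkedColoredPartitionClass n) :
    Set (W × Module.End F W) :=
  Quotient.lift (Psi V) (fun _ _ h =>
    (Psi_subset V h).antisymm (Psi_subset V (Setoid.symm h))) c

/-- The marking `μ` of `(λ, ε)` is minimal: `(λ, ε)` has the signature of the colored vector space,
`μ ≥ 0`, and no marking `δ ≠ μ` with `0 ≤ δ ≤ μ` gives the same orbit as `μ`. -/
def IsMinimalMarking (V : ZMod n → Submodule F W) (p : MarkedColoredPartition n) : Prop :=
  p.signature = spaceSignature V ∧ 0 ≤ p.mark ∧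
    ∀ (δ : ℕ → ℤ) (h : ∀ i, δ i ≤ p.len i), 0 ≤ δ → δ ≤ p.mark →
      Psi V (p.withMark δ h) = Psi V p → δ = p.mark

/-- A characteristic colored bipartition: what remains of a minimally marked colored partition
after its unmarked nonzero rows are deleted, provided all marks in the remaining nonzero rows have
the same color. -/
def IsCharacteristicBipartition (V : ZMod n → Submodule F W)
    (c : MarkedColoredPartitionClass n) : Prop :=
  ∃ p : MarkedColoredPartition n, IsMinimalMarking V p ∧
    c = MarkedColoredPartitionClass.mk p.deleteUnmarked ∧
    ∀ i j, i < j → j < p.deleteUnmarked.length →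
      p.deleteUnmarked.markColor i = p.deleteUnmarked.markColor j

end Orbits

/-! A colored nilpotent `x` has a colored Jordan basis (`exists_isColoredJordanBasis`), and its type
is determined by `x`, because the dimensions of im x^l ∩ ker x ∩ V m count the rows. So the question
is when two homogeneous vectors are related by a color-preserving automorphism commuting with `x`.

Existence of a normal form: let μ i be the highest position in row i at which v has a nonzero
coordinate. An automorphism acting on each row as a polynomial in `x` carries ∑ v_{i,μ i} to v
(`exists_marking`). If μ i ≤ μ j and λ j - μ j ≤ λ i - μ i, a commuting automorphism sends v_{j,μ j}
to v_{j,μ j} + v_{i,μ i}, so the mark of row i can be erased (`mem_enhancedOrbit_update`). When no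
mark can be erased, any two positive marks are strictly comparable, in the same direction, with
respect to both μ and λ - μ: this is `StrictMarks`.

Uniqueness: the relations x^a v ∈ im x^l are orbit invariants. For a marked vector they say that
every row has μ i ≤ a or l - a ≤ λ i - μ i (`pow_markVector_mem_range_iff`). Under strict
comparability the marked rows are the corners of the resulting staircase, so their lengths and marks
can be read off (`exists_mark_iff`); their colors follow from the V m containing v. The same
invariants show that strict markings are minimal, while erasing marks shows that minimal markings of
a single mark color are strict. Hence the characteristic bipartitions are the strict marked
partitions of admissible signature all of whose nonempty rows are marked, and the unmarked rows can
be split off freely.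

Classes of partitions are handled through row multiplicities in `ℕ∞`: equivalence is equality of
multiplicities, `∪` adds them, and the infinite supply of empty rows of each color absorbs all
discrepancies in rows of length 0. -/

/-! ### Counting rows -/

/-- The number of indices at which `f` takes the value `a`. -/
noncomputable def rowCount {α : Type*} (f : ℕ → α) (a : α) : ℕ∞ := {i | f i = a}.encard

/-- Subsets of `ℕ` are countable, so equal `encard` already gives a bijection between corresponding
fibers; these glue to a permutation. This turns every row equivalence below into an equality of
multiplicities. -/
theorem exists_perm_comp_eq_iff {α : Type*} (f g : ℕ → α) :
    (∃ σ : Equiv.Perm ℕ, g = f ∘ σ) ↔ rowCount f = rowCount g := by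
  constructor
  · rintro ⟨σ, rfl⟩
    funext a
    have : {i | f i = a} = σ '' {i | (f ∘ σ) i = a} := by
      ext i
      simp only [Set.mem_ofPred_eq, Set.mem_image, Function.comp_apply]
      exact ⟨fun h => ⟨σ.symm i, by simpa using h, by simp⟩, by rintro ⟨j, hj, rfl⟩; exact hj⟩
    rw [rowCount, this, σ.injective.encard_image]
    rfl
  · intro h
    have key : ∀ a, Nonempty ({i // g i = a} ≃ {i // f i = a}) := by
      intro a
      have h1 : Cardinal.toENat (Cardinal.mk {i // g i = a}) =
          Cardinal.toENat (Cardinal.mk {i // f i = a}) := (congrFun h a).symm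
      exact Cardinal.eq.mp
        (Cardinal.toENat_injOn Cardinal.mk_le_aleph0 Cardinal.mk_le_aleph0 h1)
    let σ : Equiv.Perm ℕ := (Equiv.sigmaFiberEquiv g).symm.trans
      ((Equiv.sigmaCongrRight fun a => (key a).some).trans (Equiv.sigmaFiberEquiv f))
    refine ⟨σ, funext fun i => ?_⟩
    exact ((key (g i)).some ⟨i, rfl⟩).2.symm

theorem rowCount_comp_perm {α : Type*} (f : ℕ → α) (σ : Equiv.Perm ℕ) :
    rowCount (f ∘ σ) = rowCount f :=
  ((exists_perm_comp_eq_iff f (f ∘ σ)).mp ⟨σ, rfl⟩).symm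

theorem rowCount_interlace {α : Type*} (f g : ℕ → α) (a : α) :
    rowCount (interlace f g) a = rowCount f a + rowCount g a := by
  have h : {i | interlace f g i = a} =
      (fun i => 2 * i + 1) '' {i | f i = a} ∪ (fun i => 2 * i) '' {i | g i = a} := by
    ext i
    simp only [Set.mem_ofPred_eq, Set.mem_union, Set.mem_image, interlace]
    rcases Nat.even_or_odd' i with ⟨k, rfl | rfl⟩
    · simp only [even_two, Even.mul_right, if_true]
      constructor
      · intro h
        exact Or.inr ⟨k, by simpa using h, rfl⟩
      · rintro (⟨j, hj, h⟩ | ⟨j, hj, h⟩)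
        · omega
        · have : j = k := by omega
          subst this
          simpa using hj
    · have h2 : (2 * k + 1) / 2 = k := by omega
      simp only [Nat.not_even_bit1, if_false, h2]
      constructor
      · intro h
        exact Or.inl ⟨k, h, rfl⟩
      · rintro (⟨j, hj, h⟩ | ⟨j, hj, h⟩)
        · have : j = k := by omega
          subst this
          exact hj
        · omega
  rw [rowCount, h, Set.encard_union_eq, Function.Injective.encard_image,
    Function.Injective.encard_image]
  · rfl
  · intro a b hab
    simpa using hab
  · intro a b hab
    simpa using hab
  · rw [Set.disjoint_left]
    rintro _ ⟨i, -, rfl⟩ ⟨j, -, h⟩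
    simp only at h
    omega

theorem rowCount_comp_nth {α : Type*} (f : ℕ → α) {S : Set ℕ} (hS : S.Finite) (a : α) :
    rowCount (f ∘ Nat.nth (· ∉ S)) a = {i | i ∉ S ∧ f i = a}.encard := by
  have hinf : {i | i ∉ S}.Infinite := hS.infinite_compl
  rw [rowCount, ← (Nat.nth_strictMono hinf).injective.encard_image]
  congr 1
  ext i
  simp only [Set.mem_image, Set.mem_ofPred_eq, Function.comp_apply]
  constructor
  · rintro ⟨k, hk, rfl⟩
    exact ⟨Nat.nth_mem_of_infinite hinf k, hk⟩
  · rintro ⟨h1, h2⟩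
    obtain ⟨k, rfl⟩ : i ∈ Set.range (Nat.nth (· ∉ S)) := by
      rw [Nat.range_nth_of_infinite (p := (· ∉ S)) hinf]
      exact h1
    exact ⟨k, h2, rfl⟩

theorem rowCount_eq_zero_iff {α : Type*} (f : ℕ → α) (a : α) :
    rowCount f a = 0 ↔ ∀ i, f i ≠ a := by
  rw [rowCount, Set.encard_eq_zero, Set.eq_empty_iff_forall_notMem]
  rfl

theorem rowCount_le_one {α : Type*} {f : ℕ → α} {a : α}
    (h : ∀ i j, f i = a → f j = a → i = j) : rowCount f a ≤ 1 :=
  Set.encard_le_one_iff.mpr fun i j hi hj => h i j hi hj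

/-! ### Rows of colored partitions -/

namespace ColoredPartition

variable {n : ℕ}

/-- The length and the color of a row. -/
def row (p : ColoredPartition n) (i : ℕ) : ℕ × ZMod n := (p.len i, p.color i)

theorem rowEquiv_iff (p q : ColoredPartition n) : p.RowEquiv q ↔ rowCount p.row = rowCount q.row := by
  rw [← exists_perm_comp_eq_iff]
  refine exists_congr fun σ => ?_
  simp only [funext_iff, row, Function.comp_apply, Prod.mk.injEq]
  exact forall_and.symm

theorem rowCount_row_lt_top (p : ColoredPartition n) {t : ℕ × ZMod n} (ht : 0 < t.1) :
    rowCount p.row t < ⊤ := by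
  rw [rowCount, Set.encard_lt_top_iff]
  refine p.finite_support.subset ?_
  rintro i rfl
  exact ht

theorem rowCount_row_zero (p : ColoredPartition n) (c : ZMod n) :
    rowCount p.row (0, c) = ⊤ := by
  rw [rowCount, Set.encard_eq_top_iff]
  refine ((p.infinite_color c).sdiff p.finite_support).mono ?_
  rintro i ⟨h1, h2⟩
  simp only [Set.mem_ofPred_eq, not_lt, nonpos_iff_eq_zero] at h1 h2
  simp [row, h1, h2]

/-- Empty rows need no comparison: each color has infinitely many of them in every colored
partition. -/
theorem rowEquiv_of_rowCount {p q : ColoredPartition n}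
    (h : ∀ t : ℕ × ZMod n, 0 < t.1 → rowCount p.row t = rowCount q.row t) : p.RowEquiv q := by
  rw [rowEquiv_iff]
  funext ⟨l, c⟩
  rcases Nat.eq_zero_or_pos l with rfl | hl
  · rw [rowCount_row_zero, rowCount_row_zero]
  · exact h _ hl

instance finite_box (p : ColoredPartition n) : Finite p.Box := by
  refine Set.Finite.to_subtype (s := {b : ℕ × ℕ | 1 ≤ b.2 ∧ b.2 ≤ p.len b.1}) ?_
  refine ((Set.finite_Iio p.length).prod (Set.finite_Iic (p.len 0))).subset ?_
  rintro ⟨i, j⟩ ⟨h1, h2⟩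
  refine ⟨(p.lt_length_iff i).mpr (lt_of_lt_of_le h1 h2), ?_⟩
  exact h2.trans (p.antitone_len (Nat.zero_le i))

/-- The boxes of color `m` in a row of given length and color. -/
abbrev RowBox (m : ZMod n) (r : ℕ × ZMod n) : Type := {k : Fin r.1 // r.2 + (k : ℕ) = m}

/-- The boxes of color `m`, sorted by rows. -/
def boxesEquiv (p : ColoredPartition n) (m : ZMod n) :
    {b : p.Box // p.boxColor b = m} ≃ Σ i, RowBox m (p.row i) where
  -- The box (i, j) is recorded as λ i - j, the number of boxes to its right, which is the quantity
  -- that enters its color.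
  toFun b := ⟨b.1.1.1, ⟨⟨p.len b.1.1.1 - b.1.1.2, by
    have h1 := b.1.2.1
    have h2 := b.1.2.2
    simp only [row]
    omega⟩, b.2⟩⟩
  invFun s := ⟨⟨(s.1, p.len s.1 - s.2.1), by
    have h := s.2.1.2
    simp only [row] at h
    dsimp only
    omega⟩, by
    have h := s.2.1.2
    have h2 := s.2.2
    simp only [row] at h h2
    simp only [boxColor]
    rw [Nat.sub_sub_self h.le]
    exact h2⟩
  left_inv := by
    rintro ⟨⟨⟨i, j⟩, h1, h2⟩, h3⟩
    simp only [Subtype.mk.injEq, Prod.mk.injEq, true_and]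
    simp only at h2
    omega
  right_inv := by
    rintro ⟨i, ⟨⟨k, hk⟩, h2⟩⟩
    simp only [row] at hk
    have : p.len i - (p.len i - k) = k := by omega
    simp [this]

theorem signature_eq_card (p : ColoredPartition n) (m : ZMod n) :
    p.signature m = Nat.card (Σ i, RowBox m (p.row i)) :=
  Nat.card_congr (p.boxesEquiv m)

instance finite_rowBoxes (p : ColoredPartition n) (m : ZMod n) :
    Finite (Σ i, RowBox m (p.row i)) :=
  Finite.of_equiv _ (p.boxesEquiv m)

/-- A finite family of rows, extended by empty rows and sorted, is a colored partition. -/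
theorem exists_row_eq [NeZero n] {ι : Type*} [Finite ι] (r : ι → ℕ × ZMod n) :
    ∃ (p : ColoredPartition n) (e : ℕ ≃ ι ⊕ (ℕ × ZMod n)),
      p.row = Sum.elim r (fun t => (0, t.2)) ∘ e := by
  have : Countable ι := Finite.to_countable
  -- The summand `ℕ × ZMod n` supplies infinitely many empty rows of each color.
  obtain ⟨e⟩ : Nonempty (ℕ ≃ ι ⊕ (ℕ × ZMod n)) := by
    have := nonempty_denumerable (ι ⊕ (ℕ × ZMod n))
    exact ⟨(Classical.choice this).eqv.symm⟩
  let R : ι ⊕ (ℕ × ZMod n) → ℕ × ZMod n := Sum.elim r (fun t => (0, t.2))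
  have hfin : ∃ N, ∀ i, N ≤ i → (R (e i)).1 = 0 := by
    have h1 : {i | (R (e i)).1 ≠ 0}.Finite := by
      refine ((Set.finite_range (Sum.inl : ι → ι ⊕ (ℕ × ZMod n))).image e.symm).subset ?_
      intro i hi
      refine ⟨e i, ?_, by simp⟩
      rcases h : e i with a | a
      · exact ⟨a, rfl⟩
      · simp [h, R] at hi
    obtain ⟨N, hN⟩ := h1.bddAbove
    refine ⟨N + 1, fun i hi => ?_⟩
    by_contra h
    have := hN h
    omega
  obtain ⟨σ, hσ⟩ := exists_perm_antitone (fun i => (R (e i)).1) hfin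
  refine ⟨⟨fun i => (R (e (σ i))).1, fun i => (R (e (σ i))).2, hσ, ?_, ?_⟩, σ.trans e, ?_⟩
  · obtain ⟨N, hN⟩ := hfin
    exact ⟨σ.symm N, by simpa using hN N le_rfl⟩
  · intro m
    have hinj : Function.Injective fun k : ℕ => σ.symm (e.symm (Sum.inr (k, m))) := by
      intro a b hab
      simpa using hab
    refine (Set.infinite_range_of_injective hinj).mono ?_
    rintro _ ⟨k, rfl⟩
    simp [R]
  · rfl

end ColoredPartition

namespace MarkedColoredPartition

variable {n : ℕ}

/-- The length, the color and the mark of a row. -/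
def row (p : MarkedColoredPartition n) (i : ℕ) : ℕ × ZMod n × ℤ := (p.len i, p.color i, p.mark i)

theorem rowEquiv_iff_exists (p q : MarkedColoredPartition n) :
    p.RowEquiv q ↔ ∃ σ : Equiv.Perm ℕ, q.row = p.row ∘ σ := by
  refine exists_congr fun σ => ?_
  simp only [funext_iff, row, Function.comp_apply, Prod.mk.injEq, forall_and]

theorem rowEquiv_iff (p q : MarkedColoredPartition n) :
    p.RowEquiv q ↔ rowCount p.row = rowCount q.row := by
  rw [rowEquiv_iff_exists, exists_perm_comp_eq_iff]

theorem interlace_prod {α β : Type*} (f f' : ℕ → α) (g g' : ℕ → β) (k : ℕ) :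
    interlace (fun i => (f i, g i)) (fun i => (f' i, g' i)) k =
      (interlace f f' k, interlace g g' k) := by
  unfold interlace
  split <;> rfl

theorem exists_row_union (p q : MarkedColoredPartition n) :
    ∃ σ : Equiv.Perm ℕ, (p.union q).row = interlace p.row q.row ∘ σ := by
  refine ⟨(exists_sort_interlace p q).choose, funext fun i => ?_⟩
  simp only [Function.comp_apply]
  unfold row
  rw [interlace_prod, interlace_prod]
  rfl

theorem rowCount_row_union (p q : MarkedColoredPartition n) (t : ℕ × ZMod n × ℤ) :
    rowCount (p.union q).row t = rowCount p.row t + rowCount q.row t := by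
  obtain ⟨σ, hσ⟩ := exists_row_union p q
  rw [hσ, rowCount_comp_perm, rowCount_interlace]

theorem exists_shape_row_union (p q : MarkedColoredPartition n) :
    ∃ σ : Equiv.Perm ℕ, (p.union q).toColoredPartition.row =
      interlace p.toColoredPartition.row q.toColoredPartition.row ∘ σ := by
  refine ⟨(exists_sort_interlace p q).choose, funext fun i => ?_⟩
  simp only [Function.comp_apply]
  unfold ColoredPartition.row
  rw [interlace_prod]
  rfl

theorem rowCount_shape_union (p q : MarkedColoredPartition n) (t : ℕ × ZMod n) :
    rowCount (p.union q).toColoredPartition.row t =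
      rowCount p.toColoredPartition.row t + rowCount q.toColoredPartition.row t := by
  obtain ⟨σ, hσ⟩ := exists_shape_row_union p q
  rw [hσ, rowCount_comp_perm, rowCount_interlace]

theorem signature_union (p q : MarkedColoredPartition n) :
    (p.union q).signature = p.signature + q.signature := by
  funext m
  obtain ⟨σ, hσ⟩ := exists_shape_row_union p q
  rw [Pi.add_apply, ColoredPartition.signature_eq_card, ColoredPartition.signature_eq_card,
    ColoredPartition.signature_eq_card, hσ, interlace_eq, add_comm, ← Nat.card_sum]
  refine Nat.card_congr ?_
  refine (Equiv.sigmaCongrLeft (β := fun s : ℕ ⊕ ℕ => ColoredPartition.RowBox m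
    (Sum.elim q.toColoredPartition.row p.toColoredPartition.row s))
    (σ.trans Equiv.natSumNatEquivNat.symm)).trans ?_
  exact Equiv.sumSigmaDistrib _

theorem signature_deleteRows_le (p : MarkedColoredPartition n) (S : Set ℕ) (hS : S.Finite) :
    (p.deleteRows S hS).signature ≤ p.signature := by
  intro m
  rw [ColoredPartition.signature_eq_card, ColoredPartition.signature_eq_card]
  refine Nat.card_le_card_of_injective
    (fun s => (⟨Nat.nth (· ∉ S) s.1, s.2⟩ : Σ i, ColoredPartition.RowBox m (p.toColoredPartition.row i)))
    ?_
  have hinj := (Nat.nth_strictMono (p := (· ∉ S)) hS.infinite_compl).injective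
  rintro ⟨i, a⟩ ⟨j, b⟩ h
  have h1 : i = j := hinj (congrArg Sigma.fst h)
  subst h1
  exact congrArg _ (eq_of_heq (Sigma.mk.inj h).2)

theorem row_deleteRows (p : MarkedColoredPartition n) (S : Set ℕ) (hS : S.Finite) :
    (p.deleteRows S hS).row = p.row ∘ Nat.nth (· ∉ S) := rfl

theorem rowCount_deleteRows (p : MarkedColoredPartition n) (S : Set ℕ) (hS : S.Finite)
    (t : ℕ × ZMod n × ℤ) :
    rowCount (p.deleteRows S hS).row t = {i | i ∉ S ∧ p.row i = t}.encard := by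
  rw [row_deleteRows, rowCount_comp_nth _ hS]

end MarkedColoredPartition

/-! ### Colored Jordan bases -/

section JordanBasis

variable {n : ℕ} {F W : Type*} [Field F] [AddCommGroup W] [Module F W]
  {p : ColoredPartition n}

theorem basisEntry_box (B : Module.Basis p.Box F W) (b : p.Box) :
    basisEntry B b.1.1 b.1.2 = B b := by
  have h1 := b.2.1
  have h2 := b.2.2
  rw [basisEntry, dif_pos ⟨by omega, by omega⟩]
  congr 1

theorem basisEntry_eq_zero (B : Module.Basis p.Box F W) {i : ℕ} {j : ℤ}
    (h : ¬ (1 ≤ j ∧ j ≤ p.len i)) : basisEntry B i j = 0 := dif_neg h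

theorem basisEntry_of_nonpos (B : Module.Basis p.Box F W) (i : ℕ) {j : ℤ}
    (h : j ≤ 0) : basisEntry B i j = 0 := basisEntry_eq_zero B (by omega)

theorem exists_box (p : ColoredPartition n) {i : ℕ} {j : ℤ} (h1 : 1 ≤ j) (h2 : j ≤ p.len i) :
    ∃ b : p.Box, b.1.1 = i ∧ (b.1.2 : ℤ) = j :=
  ⟨⟨(i, j.toNat), by dsimp only; omega, by dsimp only; omega⟩, rfl, by dsimp only; omega⟩

/-- The coordinate functional dual to `basisEntry B i j`, extended by `0`. -/
noncomputable def basisCoord (B : Module.Basis p.Box F W) (i : ℕ) (j : ℤ) : W →ₗ[F] F :=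
  if h : 1 ≤ j ∧ j ≤ p.len i then
    B.coord ⟨(i, j.toNat), by dsimp only; omega, by dsimp only; omega⟩
  else 0

theorem basisCoord_box (B : Module.Basis p.Box F W) (b : p.Box) :
    basisCoord B b.1.1 b.1.2 = B.coord b := by
  have h1 := b.2.1
  have h2 := b.2.2
  rw [basisCoord, dif_pos ⟨by omega, by omega⟩]
  congr 1

theorem basisCoord_eq_zero (B : Module.Basis p.Box F W) {i : ℕ} {j : ℤ}
    (h : ¬ (1 ≤ j ∧ j ≤ p.len i)) : basisCoord B i j = 0 := dif_neg h

theorem basisCoord_basisEntry (B : Module.Basis p.Box F W) (i i' : ℕ) (j j' : ℤ) :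
    basisCoord B i j (basisEntry B i' j') =
      if i = i' ∧ j = j' ∧ 1 ≤ j ∧ j ≤ p.len i then 1 else 0 := by
  by_cases h : 1 ≤ j ∧ j ≤ p.len i
  · by_cases h' : 1 ≤ j' ∧ j' ≤ p.len i'
    · obtain ⟨b, rfl, rfl⟩ := exists_box p h.1 h.2
      obtain ⟨b', rfl, rfl⟩ := exists_box p h'.1 h'.2
      rw [basisCoord_box, basisEntry_box, Module.Basis.coord_apply, Module.Basis.repr_self,
        Finsupp.single_apply]
      refine if_congr ?_ rfl rfl
      rw [Subtype.ext_iff, Prod.ext_iff]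
      have := b.2
      omega
    · rw [basisEntry_eq_zero B h', map_zero, if_neg]
      rintro ⟨rfl, rfl, h3⟩
      exact h' h3
  · rw [basisCoord_eq_zero B h, LinearMap.zero_apply, if_neg]
    exact fun h' => h h'.2.2

theorem basisCoord_ext (B : Module.Basis p.Box F W) {w w' : W}
    (h : ∀ (i : ℕ) (j : ℤ), 1 ≤ j → j ≤ p.len i → basisCoord B i j w = basisCoord B i j w') :
    w = w' := by
  refine B.ext_elem fun b => ?_
  have h1 := b.2.1
  have h2 := b.2.2
  have := h b.1.1 b.1.2 (by omega) (by omega)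
  rwa [basisCoord_box] at this

theorem sum_coord_smul_basis [Fintype p.Box] (B : Module.Basis p.Box F W) (w : W) :
    ∑ b, basisCoord B b.1.1 b.1.2 w • B b = w := by
  simp only [basisCoord_box, Module.Basis.coord_apply]
  exact B.sum_repr w

variable {V : ZMod n → Submodule F W} {x : Module.End F W} {B : Module.Basis p.Box F W}

theorem IsColoredJordanBasis.apply_basisEntry (hB : IsColoredJordanBasis V x B) (i : ℕ) {j : ℤ}
    (hj : j ≤ p.len i) : x (basisEntry B i j) = basisEntry B i (j - 1) := by
  by_cases h : 1 ≤ j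
  · obtain ⟨b, rfl, rfl⟩ := exists_box p h hj
    rw [basisEntry_box, hB.2]
  · rw [basisEntry_of_nonpos B i (by omega), basisEntry_of_nonpos B i (by omega), map_zero]

theorem IsColoredJordanBasis.pow_apply_basisEntry (hB : IsColoredJordanBasis V x B) (i : ℕ) {j : ℤ}
    (hj : j ≤ p.len i) (k : ℕ) : (x ^ k) (basisEntry B i j) = basisEntry B i (j - k) := by
  induction k with
  | zero => simp
  | succ k ih =>
    rw [pow_succ', Module.End.mul_apply, ih, hB.apply_basisEntry i (by omega)]
    congr 1
    push_cast
    ring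

theorem IsColoredJordanBasis.basisEntry_mem (hB : IsColoredJordanBasis V x B) (i : ℕ) (j : ℤ) :
    basisEntry B i j ∈ V (p.color i + ((p.len i - j : ℤ) : ZMod n)) := by
  by_cases h : 1 ≤ j ∧ j ≤ p.len i
  · obtain ⟨b, rfl, rfl⟩ := exists_box p h.1 h.2
    rw [basisEntry_box]
    have := hB.1 b
    rw [ColoredPartition.boxColor] at this
    convert this using 2
    push_cast [Nat.cast_sub b.2.2]
    rfl
  · rw [basisEntry_eq_zero B h]
    exact zero_mem _

/-- Dual to the shift of the basis vectors. For j ≤ 0 the left side is 0 by convention while the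
right side need not be, hence the bound on `j`. -/
theorem IsColoredJordanBasis.basisCoord_pow (hB : IsColoredJordanBasis V x B) (i : ℕ) {j : ℤ}
    (hj : 1 ≤ j) (k : ℕ) (w : W) :
    basisCoord B i j ((x ^ k) w) = basisCoord B i (j + k) w := by
  suffices h : basisCoord B i j ∘ₗ (x ^ k) = basisCoord B i (j + k) from LinearMap.congr_fun h w
  refine B.ext fun b => ?_
  have h2 := b.2.2
  rw [← basisEntry_box, LinearMap.comp_apply, hB.pow_apply_basisEntry _ (by omega),
    basisCoord_basisEntry, basisCoord_basisEntry]
  refine if_congr ?_ rfl rfl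
  constructor
  · rintro ⟨rfl, h, h3, h4⟩
    omega
  · rintro ⟨rfl, h, h3, h4⟩
    omega

/-- The image of x^l is spanned by the v_{i,j} that have at least l boxes to their right. -/
theorem IsColoredJordanBasis.mem_range_pow_iff (hB : IsColoredJordanBasis V x B) (l : ℕ) (w : W) :
    w ∈ LinearMap.range (x ^ l) ↔
      ∀ (i : ℕ) (j : ℤ), 1 ≤ j → p.len i < j + l → basisCoord B i j w = 0 := by
  constructor
  · rintro ⟨y, rfl⟩ i j h1 h2
    rw [hB.basisCoord_pow i h1, basisCoord_eq_zero B (by omega), LinearMap.zero_apply]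
  · intro h
    have := Fintype.ofFinite p.Box
    rw [← sum_coord_smul_basis B w]
    refine Submodule.sum_mem _ fun b _ => ?_
    have h1 := b.2.1
    by_cases h2 : p.len b.1.1 < (b.1.2 : ℤ) + l
    · rw [h _ _ (by omega) h2, zero_smul]
      exact zero_mem _
    · refine Submodule.smul_mem _ _ ⟨basisEntry B b.1.1 (b.1.2 + l), ?_⟩
      rw [hB.pow_apply_basisEntry _ (by omega), add_sub_cancel_right, basisEntry_box]

theorem IsColoredJordanBasis.mem_ker_iff (hB : IsColoredJordanBasis V x B) (w : W) :
    w ∈ LinearMap.ker x ↔ ∀ (i : ℕ) (j : ℤ), 2 ≤ j → basisCoord B i j w = 0 := by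
  rw [LinearMap.mem_ker]
  constructor
  · intro h i j hj
    have := hB.basisCoord_pow i (j := j - 1) (by omega) 1 w
    rw [pow_one, h, map_zero] at this
    rw [this]
    congr 2
    push_cast
    ring
  · intro h
    refine basisCoord_ext B fun i j h1 h2 => ?_
    have := hB.basisCoord_pow i h1 1 w
    rw [pow_one] at this
    rw [this, map_zero]
    exact h _ _ (by push_cast; omega)

/-- Write w ∈ V i as a + b with a ∈ U i and b in the sum of the other U j. Then b = w - a lies in V
i as well, so it vanishes by independence. -/
theorem span_eq_of_iSupIndep {ι : Type*} (V : ι → Submodule F W)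
    (hV : iSupIndep V) (U : ι → Submodule F W) (hU : U ≤ V) (htop : ⨆ i, U i = ⊤) (i : ι) :
    V i = U i := by
  refine le_antisymm (fun w hw => ?_) (hU i)
  have hw' : w ∈ U i ⊔ ⨆ (j) (_ : j ≠ i), U j := by
    have : (⨆ j, U j) ≤ U i ⊔ ⨆ (j) (_ : j ≠ i), U j := by
      refine iSup_le fun j => ?_
      by_cases h : j = i
      · rw [h]
        exact le_sup_left
      · exact le_sup_of_le_right (le_iSup₂_of_le j h le_rfl)
    exact this (htop ▸ Submodule.mem_top)
  obtain ⟨a, ha, b, hb, rfl⟩ := Submodule.mem_sup.mp hw'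
  have hb' : b ∈ V i := by
    have := Submodule.sub_mem _ hw (hU i ha)
    rwa [add_sub_cancel_left] at this
  have hb2 : b ∈ ⨆ (j) (_ : j ≠ i), V j := (iSup₂_mono fun j _ => hU j) hb
  have : b = 0 := Submodule.disjoint_def.mp (hV i) b hb' hb2
  rw [this, add_zero]
  exact ha

theorem eq_span_of_basis_mem {ι κ : Type*} {V : ι → Submodule F W} (hV : iSupIndep V)
    (B : Module.Basis κ F W) (c : κ → ι) (hB : ∀ b, B b ∈ V (c b)) (m : ι) :
    V m = Submodule.span F (B '' {b | c b = m}) := by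
  refine span_eq_of_iSupIndep V hV (fun m => Submodule.span F (B '' {b | c b = m})) ?_ ?_ m
  · intro m
    rw [Submodule.span_le]
    rintro _ ⟨b, rfl, rfl⟩
    exact hB b
  · rw [eq_top_iff, ← B.span_eq, Submodule.span_le]
    rintro _ ⟨b, rfl⟩
    exact Submodule.mem_iSup_of_mem (c b) (Submodule.subset_span ⟨b, rfl, rfl⟩)

theorem finrank_span_image_basis {κ : Type*} [Finite κ] (B : Module.Basis κ F W) (S : Set κ) :
    Module.finrank F (Submodule.span F (B '' S)) = S.ncard := by
  have := Fintype.ofFinite S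
  rw [Set.image_eq_range, finrank_span_eq_card (b := fun s : S => B s)
    (B.linearIndependent.comp _ Subtype.val_injective), Set.ncard_eq_toFinset_card',
    Set.toFinset_card]

variable (hV : DirectSum.IsInternal V)
include hV

theorem IsColoredJordanBasis.mem_iff (hB : IsColoredJordanBasis V x B) (m : ZMod n) (w : W) :
    w ∈ V m ↔ ∀ b : p.Box, p.boxColor b ≠ m → basisCoord B b.1.1 b.1.2 w = 0 := by
  rw [eq_span_of_basis_mem hV.submodule_iSupIndep B p.boxColor hB.1 m,
    Module.Basis.mem_span_image]
  simp only [basisCoord_box, Module.Basis.coord_apply]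
  constructor
  · intro h b hb
    by_contra h'
    exact hb (h (Finsupp.mem_support_iff.mpr h'))
  · intro h b hb
    by_contra h'
    exact Finsupp.mem_support_iff.mp hb (h b h')

theorem IsColoredJordanBasis.signature_eq (hB : IsColoredJordanBasis V x B) :
    p.signature = spaceSignature V := by
  funext m
  rw [spaceSignature, eq_span_of_basis_mem hV.submodule_iSupIndep B p.boxColor hB.1 m,
    finrank_span_image_basis]
  rfl

/-- The number of rows of length `> l` whose first box has color `m` is the dimension of
`im x ^ l ∩ ker x ∩ V m`. -/
theorem IsColoredJordanBasis.finrank_range_inf_ker (hB : IsColoredJordanBasis V x B) (l : ℕ)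
    (m : ZMod n) :
    Module.finrank F (LinearMap.range (x ^ l) ⊓ LinearMap.ker x ⊓ V m : Submodule F W) =
      {i | l < p.len i ∧ p.color i + ((p.len i - 1 : ℕ) : ZMod n) = m}.ncard := by
  let S : Set p.Box := {b | b.1.2 = 1 ∧ l < p.len b.1.1 ∧ p.boxColor b = m}
  have h1 : (LinearMap.range (x ^ l) ⊓ LinearMap.ker x ⊓ V m : Submodule F W) =
      Submodule.span F (B '' S) := by
    ext w
    rw [Submodule.mem_inf, Submodule.mem_inf, hB.mem_range_pow_iff, hB.mem_ker_iff,
      hB.mem_iff hV, Module.Basis.mem_span_image]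
    constructor
    · rintro ⟨⟨h1, h2⟩, h3⟩ b hb
      have hb' : basisCoord B b.1.1 b.1.2 w ≠ 0 := by
        rw [basisCoord_box]
        exact Finsupp.mem_support_iff.mp hb
      have hb1 := b.2.1
      refine ⟨?_, ?_, ?_⟩
      · by_contra h
        exact hb' (h2 _ _ (by omega))
      · by_contra h
        exact hb' (h1 _ _ (by omega) (by omega))
      · by_contra h
        exact hb' (h3 _ h)
    · intro h
      have key : ∀ b : p.Box, basisCoord B b.1.1 b.1.2 w ≠ 0 → b ∈ S := by
        intro b hb
        rw [basisCoord_box] at hb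
        exact h (Finsupp.mem_support_iff.mpr hb)
      refine ⟨⟨fun i j h1 h2 => ?_, fun i j h1 => ?_⟩, fun b hb => ?_⟩
      · by_contra hne
        by_cases hj : j ≤ p.len i
        · obtain ⟨b, rfl, rfl⟩ := exists_box p h1 hj
          obtain ⟨h3, h4, -⟩ := key b hne
          omega
        · rw [basisCoord_eq_zero B (by omega)] at hne
          exact hne rfl
      · by_contra hne
        by_cases hj : j ≤ p.len i
        · obtain ⟨b, rfl, rfl⟩ := exists_box p (by omega) hj
          obtain ⟨h3, h4, -⟩ := key b hne
          omega
        · rw [basisCoord_eq_zero B (by omega)] at hne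
          exact hne rfl
      · by_contra hne
        exact hb (key b hne).2.2
  rw [h1, finrank_span_image_basis]
  refine Set.ncard_congr (fun b _ => b.1.1) ?_ ?_ ?_
  · rintro ⟨⟨i, j⟩, hj⟩ ⟨rfl, h2, h3⟩
    exact ⟨h2, h3⟩
  · rintro ⟨⟨i, j⟩, hj⟩ ⟨⟨i', j'⟩, hj'⟩ ⟨rfl, h2, h3⟩ ⟨rfl, h2', h3'⟩ rfl
    rfl
  · rintro i ⟨h1, h2⟩
    exact ⟨⟨(i, 1), le_rfl, by dsimp only; omega⟩, ⟨rfl, h1, h2⟩, rfl⟩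

/-- Two colored Jordan bases of the same endomorphism have the same type. -/
theorem IsColoredJordanBasis.rowEquiv (hB : IsColoredJordanBasis V x B) {q : ColoredPartition n}
    {C : Module.Basis q.Box F W} (hC : IsColoredJordanBasis V x C) : p.RowEquiv q := by
  -- A row of length l + 1 and color c has first box of color c + l. Hence its multiplicity is the
  -- difference of two consecutive counts, each of which is a dimension depending only on `x`.
  have key : ∀ (r : ColoredPartition n) (l : ℕ) (c : ZMod n),
      {i | l < r.len i ∧ r.color i + ((r.len i - 1 : ℕ) : ZMod n) = c + (l : ℕ)}.ncard =
      {i | r.row i = (l + 1, c)}.ncard +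
        {i | l + 1 < r.len i ∧ r.color i + ((r.len i - 1 : ℕ) : ZMod n) = c + (l : ℕ)}.ncard := by
    intro r l c
    rw [← Set.ncard_union_eq ?_ ?_ ?_]
    · congr 1
      ext i
      simp only [Set.mem_ofPred_eq, Set.mem_union, ColoredPartition.row, Prod.mk.injEq]
      constructor
      · rintro ⟨h1, h2⟩
        by_cases h : r.len i = l + 1
        · left
          refine ⟨h, ?_⟩
          rw [h] at h2
          simpa using h2
        · right
          exact ⟨by omega, h2⟩
      · rintro (⟨h1, h2⟩ | ⟨h1, h2⟩)
        · refine ⟨by omega, ?_⟩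
          rw [h1, h2]
          simp
        · exact ⟨by omega, h2⟩
    · rw [Set.disjoint_left]
      rintro i h1 ⟨h2, -⟩
      have : r.len i = l + 1 := congrArg Prod.fst h1
      omega
    · refine r.finite_support.subset fun i hi => ?_
      have : r.len i = l + 1 := congrArg Prod.fst hi
      simp [this]
    · refine r.finite_support.subset fun i hi => ?_
      exact lt_of_le_of_lt (Nat.zero_le _) hi.1
  refine ColoredPartition.rowEquiv_of_rowCount ?_
  rintro ⟨l, c⟩ hl
  obtain ⟨l, rfl⟩ : ∃ k, l = k + 1 := ⟨l - 1, by dsimp only at hl; omega⟩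
  have e1 := key p l c
  have e2 := key q l c
  rw [← hB.finrank_range_inf_ker hV, ← hB.finrank_range_inf_ker hV] at e1
  rw [← hC.finrank_range_inf_ker hV, ← hC.finrank_range_inf_ker hV, e1] at e2
  have e3 := Nat.add_right_cancel e2
  rw [rowCount, rowCount, ← Set.Finite.cast_ncard_eq, ← Set.Finite.cast_ncard_eq, e3]
  · exact Set.encard_lt_top_iff.mp (q.rowCount_row_lt_top hl)
  · exact Set.encard_lt_top_iff.mp (p.rowCount_row_lt_top hl)

end JordanBasis

/-! ### Existence of colored Jordan bases -/

section Existence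

variable {n : ℕ} {F W : Type*} [Field F] [AddCommGroup W] [Module F W]
  {V : ZMod n → Submodule F W} {x : Module.End F W}

theorem pow_apply_mem_of_mem_nilpotentCone (hx : x ∈ nilpotentCone V) (k : ℕ) {m : ZMod n} {w : W}
    (hw : w ∈ V m) : (x ^ k) w ∈ V (m + k) := by
  induction k with
  | zero => simpa using hw
  | succ k ih =>
    rw [pow_succ', Module.End.mul_apply]
    push_cast
    rw [← add_assoc]
    exact hx.2 _ _ ih

/-- If `φ (x ^ K v) ≠ 0` and `x ^ (K + 1) v = 0`, then the functionals `φ ∘ x ^ a`, `a ≤ K`, take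
arbitrary values on the span of the `x ^ j v`, `j ≤ K`. -/
theorem exists_combination_of_chain (φ : W →ₗ[F] F) {v : W} {K : ℕ} (h1 : φ ((x ^ K) v) ≠ 0)
    (h2 : (x ^ (K + 1)) v = 0) (y : Fin (K + 1) → F) :
    ∃ c : Fin (K + 1) → F, ∀ a : Fin (K + 1),
      φ ((x ^ (a : ℕ)) (∑ j, c j • (x ^ (j : ℕ)) v)) = y a := by
  let L : (Fin (K + 1) → F) →ₗ[F] (Fin (K + 1) → F) :=
    (LinearMap.pi fun a : Fin (K + 1) => φ ∘ₗ (x ^ (a : ℕ))) ∘ₗ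
      Fintype.linearCombination F (fun j : Fin (K + 1) => (x ^ (j : ℕ)) v)
  have hL : ∀ c a, L c a = ∑ j : Fin (K + 1), c j * φ ((x ^ ((a : ℕ) + j)) v) := by
    intro c a
    simp only [L, LinearMap.comp_apply, LinearMap.pi_apply, Fintype.linearCombination_apply,
      map_sum, map_smul, smul_eq_mul, pow_add, Module.End.mul_apply]
  have hzero : ∀ k, K < k → (x ^ k) v = 0 := by
    intro k hk
    obtain ⟨d, rfl⟩ := Nat.exists_eq_add_of_lt hk
    rw [show K + d + 1 = d + (K + 1) by ring, pow_add, Module.End.mul_apply, h2, map_zero]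
  have hinj : Function.Injective L := by
    rw [← LinearMap.ker_eq_bot, LinearMap.ker_eq_bot']
    intro c hc
    -- The matrix φ(x^(a+j) v) vanishes for a + j > K and is nonzero for a + j = K. Row a = K - k
    -- therefore isolates c k once the earlier coefficients are known to be 0.
    have key : ∀ (k : ℕ) (hk : k < K + 1), c ⟨k, hk⟩ = 0 := by
      intro k
      induction k using Nat.strong_induction_on with
      | _ k ih =>
        intro hk
        have := hL c ⟨K - k, by omega⟩
        rw [hc, Pi.zero_apply, Finset.sum_eq_single ⟨k, hk⟩] at this
        · simp only at this
          rw [Nat.sub_add_cancel (by omega)] at this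
          exact (mul_eq_zero.mp this.symm).resolve_right h1
        · rintro ⟨j, hj⟩ - hne
          rcases lt_or_gt_of_ne (fun h : j = k => hne (by simp [h])) with h | h
          · rw [ih j h hj, zero_mul]
          · simp only
            rw [hzero _ (by omega), map_zero, mul_zero]
        · simp
    funext ⟨k, hk⟩
    exact key k hk
  obtain ⟨c, hc⟩ := LinearMap.injective_iff_surjective.mp hinj y
  refine ⟨c, fun a => ?_⟩
  rw [← hc]
  simp only [L, LinearMap.comp_apply, LinearMap.pi_apply, Fintype.linearCombination_apply]

variable [FiniteDimensional F W]

/-- Every colored partition of the right signature is the type of a colored Jordan basis. -/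
theorem exists_isColoredJordanBasis_of_signature (hV : DirectSum.IsInternal V)
    (p : ColoredPartition n) (hp : p.signature = spaceSignature V) :
    ∃ x ∈ nilpotentCone V, ∃ B : Module.Basis p.Box F W, IsColoredJordanBasis V x B := by
  have heq : ∀ m, Nonempty (Fin (Module.finrank F (V m)) ≃ {b : p.Box // p.boxColor b = m}) := by
    intro m
    exact ⟨(Finite.equivFinOfCardEq (congrFun hp m)).symm⟩
  let C := hV.collectedBasis fun m => Module.finBasis F (V m)
  -- The signature condition lets the boxes of color m label a basis of V m; `x` is then defined as
  -- the shift to the left along rows.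
  let E : (Σ m, Fin (Module.finrank F (V m))) ≃ p.Box :=
    (Equiv.sigmaCongrRight fun m => (heq m).some).trans (Equiv.sigmaFiberEquiv p.boxColor)
  have hE : ∀ s, p.boxColor (E s) = s.1 := fun s => ((heq s.1).some s.2).2
  let B : Module.Basis p.Box F W := C.reindex E
  have hB1 : ∀ b, B b ∈ V (p.boxColor b) := by
    intro b
    obtain ⟨s, rfl⟩ := E.surjective b
    rw [hE, Module.Basis.reindex_apply, Equiv.symm_apply_apply]
    exact hV.collectedBasis_mem _ s
  let x : Module.End F W := B.constr F fun b => basisEntry B b.1.1 ((b.1.2 : ℤ) - 1)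
  have hB : IsColoredJordanBasis V x B := ⟨hB1, fun b => B.constr_basis F _ b⟩
  refine ⟨x, ⟨⟨p.len 0, ?_⟩, ?_⟩, B, hB⟩
  · refine B.ext fun b => ?_
    have h1 := b.2.2
    have h2 := p.antitone_len (Nat.zero_le b.1.1)
    rw [← basisEntry_box, hB.pow_apply_basisEntry _ (by omega),
      basisEntry_of_nonpos _ _ (by omega), LinearMap.zero_apply]
  · intro m
    rw [eq_span_of_basis_mem hV.submodule_iSupIndep B p.boxColor hB1 m]
    intro v hv
    have : Submodule.span F (B '' {b | p.boxColor b = m}) ≤ (V (m + 1)).comap x := by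
      rw [Submodule.span_le]
      rintro _ ⟨b, rfl, rfl⟩
      have h3 := hB.basisEntry_mem b.1.1 ((b.1.2 : ℤ) - 1)
      simp only [SetLike.mem_coe, Submodule.mem_comap]
      rw [hB.2]
      convert h3 using 2
      rw [ColoredPartition.boxColor, Nat.cast_sub b.2.2]
      push_cast
      ring
    exact this hv

variable [NeZero n]

/-- A homogeneous `x`-stable subspace is spanned by homogeneous Jordan chains, whose total length is
at most its dimension. -/
theorem exists_jordan_chains (hV : iSupIndep V) (hx : x ∈ nilpotentCone V) (d : ℕ)
    (U : Submodule F W) (hd : Module.finrank F U ≤ d) (hU : ∀ w ∈ U, x w ∈ U)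
    (hom : ∀ w ∈ U, ∃ f : ZMod n → W, (∀ m, f m ∈ V m ∧ f m ∈ U) ∧ ∑ m, f m = w) :
    ∃ L : List (ℕ × ZMod n × W), (∀ t ∈ L, t.2.2 ∈ V t.2.1 ∧ (x ^ t.1) t.2.2 = 0) ∧
      U ≤ Submodule.span F {w | ∃ t ∈ L, ∃ j < t.1, w = (x ^ j) t.2.2} ∧
      (L.map fun t => t.1).sum ≤ Module.finrank F U := by
  classical
  induction d generalizing U with
  | zero =>
    have : U = ⊥ := Submodule.finrank_eq_zero.mp (by omega)
    subst this
    exact ⟨[], by simp, by simp, by simp⟩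
  | succ d ih =>
    by_cases hbot : U = ⊥
    · subst hbot
      exact ⟨[], by simp, by simp, by simp⟩
    have hpowU : ∀ (k : ℕ), ∀ w ∈ U, (x ^ k) w ∈ U := by
      intro k
      induction k with
      | zero => exact fun w hw => by simpa using hw
      | succ k ihk =>
        intro w hw
        rw [pow_succ', Module.End.mul_apply]
        exact hU _ (ihk w hw)
    have hex : ∃ k, ∀ w ∈ U, (x ^ k) w = 0 := by
      obtain ⟨k, hk⟩ := hx.1
      exact ⟨k, fun w _ => by rw [hk, LinearMap.zero_apply]⟩
    obtain ⟨K, hK⟩ : ∃ K, Nat.find hex = K + 1 := by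
      refine Nat.exists_eq_succ_of_ne_zero fun h => hbot ?_
      have := Nat.find_spec hex
      rw [h] at this
      exact (Submodule.eq_bot_iff U).mpr fun w hw => by simpa using this w hw
    have hK0 : ∀ w ∈ U, (x ^ (K + 1)) w = 0 := hK ▸ Nat.find_spec hex
    have hK1 : ¬ ∀ w ∈ U, (x ^ K) w = 0 := Nat.find_min hex (by omega)
    -- A homogeneous generator of a longest chain in `U`: if x^K killed every homogeneous vector of
    -- `U`, it would kill `U`.
    obtain ⟨c, v, hvV, hvU, hv⟩ : ∃ c v, v ∈ V c ∧ v ∈ U ∧ (x ^ K) v ≠ 0 := by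
      by_contra! h
      refine hK1 fun w hw => ?_
      obtain ⟨f, hf, rfl⟩ := hom w hw
      rw [map_sum]
      exact Finset.sum_eq_zero fun m _ => h m _ (hf m).1 (hf m).2
    -- Making φ vanish on all colors but that of x^K v is what keeps the complement of the chain
    -- homogeneous.
    obtain ⟨φ, hφ1, hφ2⟩ : ∃ φ : W →ₗ[F] F, φ ((x ^ K) v) ≠ 0 ∧
        (⨆ (m) (_ : m ≠ c + (K : ZMod n)), V m) ≤ LinearMap.ker φ := by
      refine Submodule.exists_le_ker_of_notMem fun h => hv ?_
      exact Submodule.disjoint_def.mp (hV (c + (K : ZMod n))) _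
        (pow_apply_mem_of_mem_nilpotentCone hx K hvV) h
    have hφ0 : ∀ m w, w ∈ V m → m ≠ c + (K : ZMod n) → φ w = 0 := fun m w hw hm =>
      hφ2 (Submodule.mem_iSup_of_mem m (Submodule.mem_iSup_of_mem hm hw))
    let Φ : W →ₗ[F] (Fin (K + 1) → F) := LinearMap.pi fun a : Fin (K + 1) => φ ∘ₗ (x ^ (a : ℕ))
    have hΦ : ∀ w, w ∈ LinearMap.ker Φ ↔ ∀ a < K + 1, φ ((x ^ a) w) = 0 := by
      intro w
      rw [LinearMap.mem_ker, funext_iff]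
      exact ⟨fun h a ha => h ⟨a, ha⟩, fun h a => h a a.2⟩
    have hcomb : ∀ y, ∃ u : Fin (K + 1) → F, Φ (∑ j, u j • (x ^ (j : ℕ)) v) = y := by
      intro y
      obtain ⟨u, hu⟩ := exists_combination_of_chain φ hφ1 (hK0 v hvU) y
      exact ⟨u, funext hu⟩
    have hcombU : ∀ u : Fin (K + 1) → F, ∑ j, u j • (x ^ (j : ℕ)) v ∈ U := fun u =>
      Submodule.sum_mem _ fun j _ => Submodule.smul_mem _ _ (hpowU _ _ hvU)
    -- The functionals φ ∘ x^a, a ≤ K, cut out a complement in `U` to the chain of v, of codimension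
    -- K + 1. It is x-stable because x^(K+1) kills `U`, so the induction applies to it.
    let U' : Submodule F W := U ⊓ LinearMap.ker Φ
    have hfin : Module.finrank F U' + (K + 1) = Module.finrank F U := by
      have h1 := LinearMap.finrank_range_add_finrank_ker (Φ.domRestrict U)
      have h2 : LinearMap.range (Φ.domRestrict U) = ⊤ := by
        rw [LinearMap.range_eq_top]
        intro y
        obtain ⟨u, hu⟩ := hcomb y
        exact ⟨⟨_, hcombU u⟩, hu⟩
      have h3 : U' = (LinearMap.ker (Φ.domRestrict U)).map U.subtype := by
        rw [LinearMap.domRestrict, LinearMap.ker_comp, Submodule.map_comap_subtype]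
      rw [h2, finrank_top, Module.finrank_fin_fun] at h1
      rw [h3, Submodule.finrank_map_subtype_eq]
      omega
    obtain ⟨L, hL1, hL2, hL3⟩ := ih U' (by omega) (by
      rintro w ⟨h1, h2⟩
      refine ⟨hU w h1, (hΦ _).mpr fun a ha => ?_⟩
      rw [← Module.End.mul_apply, ← pow_succ]
      by_cases ha' : a + 1 < K + 1
      · exact (hΦ w).mp h2 _ ha'
      · rw [show a + 1 = K + 1 by omega, hK0 w h1, map_zero]) (by
      rintro w ⟨h1, h2⟩
      obtain ⟨f, hf, rfl⟩ := hom w h1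
      refine ⟨f, fun m => ⟨(hf m).1, (hf m).2, (hΦ _).mpr fun a ha => ?_⟩, rfl⟩
      have hmem : ∀ m', (x ^ a) (f m') ∈ V (m' + a) := fun m' =>
        pow_apply_mem_of_mem_nilpotentCone hx a (hf m').1
      by_cases hm : m + (a : ZMod n) = c + (K : ZMod n)
      · have := (hΦ _).mp h2 a ha
        rw [map_sum, map_sum, Finset.sum_eq_single m] at this
        · exact this
        · intro m' _ hm'
          exact hφ0 _ _ (hmem m') fun h => hm' (add_right_cancel (h.trans hm.symm))
        · simp
      · exact hφ0 _ _ (hmem m) hm)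
    refine ⟨(K + 1, c, v) :: L, ?_, ?_, ?_⟩
    · intro t ht
      rcases List.mem_cons.mp ht with rfl | ht
      · exact ⟨hvV, hK0 v hvU⟩
      · exact hL1 t ht
    · intro w hw
      obtain ⟨u, hu⟩ := hcomb (Φ w)
      -- The combination of chain vectors with the same Φ-values as w splits w into a part in U' and
      -- a part in the span of the new chain.
      rw [← sub_add_cancel w (∑ j, u j • (x ^ (j : ℕ)) v)]
      refine Submodule.add_mem _ ?_ ?_
      · refine Submodule.span_mono ?_ (hL2 ⟨Submodule.sub_mem _ hw (hcombU u), ?_⟩)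
        · rintro _ ⟨t, ht, j, hj, rfl⟩
          exact ⟨t, List.mem_cons_of_mem _ ht, j, hj, rfl⟩
        · rw [SetLike.mem_coe, LinearMap.mem_ker, map_sub, hu, sub_self]
      · refine Submodule.sum_mem _ fun j _ => Submodule.smul_mem _ _ (Submodule.subset_span ?_)
        exact ⟨_, List.mem_cons_self, j, j.2, rfl⟩
    · simp only [List.map_cons, List.sum_cons]
      omega

/-- Homogeneous chains for the whole space become the nonempty rows. They span, and their total
length is at most the dimension, so their vectors form a basis without a separate proof of
independence. -/
theorem exists_isColoredJordanBasis (hV : DirectSum.IsInternal V) (hx : x ∈ nilpotentCone V) :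
    ∃ (p : ColoredPartition n) (B : Module.Basis p.Box F W), IsColoredJordanBasis V x B := by
  obtain ⟨L, hL1, hL2, hL3⟩ := exists_jordan_chains hV.submodule_iSupIndep hx _ ⊤ le_rfl
    (fun _ _ => Submodule.mem_top) (by
      intro w _
      have hw : w ∈ ⨆ m ∈ (Finset.univ : Finset (ZMod n)), V m := by
        simp [hV.submodule_iSup_eq_top]
      obtain ⟨f, hf⟩ := (Submodule.mem_iSup_finset_iff_exists_sum _ _).mp hw
      exact ⟨fun m => f m, fun m => ⟨(f m).2, Submodule.mem_top⟩, hf⟩)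
  obtain ⟨p, e, he⟩ := ColoredPartition.exists_row_eq
    (fun a : Fin L.length => (L[a].1, L[a].2.1))
  let g : ℕ → W := fun i => Sum.elim (fun a : Fin L.length => L[a].2.2) 0 (e i)
  have hlen : ∀ i, p.len i = Sum.elim (fun a : Fin L.length => L[a].1) 0 (e i) := by
    intro i
    have := congrArg Prod.fst (congrFun he i)
    rcases h : e i with a | a <;> simpa [h, ColoredPartition.row] using this
  have hg : ∀ i, 0 < p.len i → g i ∈ V (p.color i) := by
    intro i hi
    have hc := congrArg Prod.snd (congrFun he i)
    have hl := hlen i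
    rcases h : e i with a | a
    · simp only [h, ColoredPartition.row, Function.comp_apply, Sum.elim_inl] at hc
      simp only [g, h, Sum.elim_inl, hc]
      exact (hL1 _ (List.getElem_mem _)).1
    · simp [h] at hl
      omega
  have hg0 : ∀ i, (x ^ p.len i) (g i) = 0 := by
    intro i
    rw [hlen i]
    rcases h : e i with a | a
    · simp only [g, h, Sum.elim_inl]
      exact (hL1 _ (List.getElem_mem _)).2
    · simp [g, h]
  -- The generator of a chain sits in the last box of its row, so the color of the row is the color
  -- of the generator.
  let b : p.Box → W := fun s => (x ^ (p.len s.1.1 - s.1.2)) (g s.1.1)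
  have := Fintype.ofFinite p.Box
  have hspan : ⊤ ≤ Submodule.span F (Set.range b) := by
    refine hL2.trans (Submodule.span_mono ?_)
    rintro _ ⟨t, ht, j, hj, rfl⟩
    obtain ⟨a, ha, rfl⟩ := List.mem_iff_getElem.mp ht
    have hl := hlen (e.symm (Sum.inl ⟨a, ha⟩))
    simp only [Equiv.apply_symm_apply, Sum.elim_inl, Fin.getElem_fin] at hl
    refine ⟨⟨(e.symm (Sum.inl ⟨a, ha⟩), p.len (e.symm (Sum.inl ⟨a, ha⟩)) - j), ?_⟩, ?_⟩
    · dsimp only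
      omega
    · simp only [b, g, Equiv.apply_symm_apply, Sum.elim_inl, Fin.getElem_fin]
      rw [hl]
      congr 2
      omega
  have hcard : Fintype.card p.Box ≤ Module.finrank F W := by
    -- Every box comes from a position in one of the chains; the added rows are empty and contribute
    -- no box.
    let f : (Σ a : Fin L.length, Fin L[a].1) → p.Box := fun t =>
      ⟨(e.symm (Sum.inl t.1), p.len (e.symm (Sum.inl t.1)) - t.2), by
        have h1 := hlen (e.symm (Sum.inl t.1))
        have h2 := t.2.2
        rw [Equiv.apply_symm_apply, Sum.elim_inl] at h1
        dsimp only
        omega⟩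
    have hf : Function.Surjective f := by
      rintro ⟨⟨i, j⟩, h1, h2⟩
      have hl := hlen i
      simp only at h1 h2
      rcases h : e i with a | a
      · rw [h, Sum.elim_inl] at hl
        have hi : e.symm (Sum.inl a) = i := by rw [← h, Equiv.symm_apply_apply]
        refine ⟨⟨a, ⟨p.len i - j, by omega⟩⟩, Subtype.ext (Prod.ext hi ?_)⟩
        simp only [f, hi]
        omega
      · rw [h, Sum.elim_inr, Pi.zero_apply] at hl
        omega
    refine (Fintype.card_le_of_surjective f hf).trans ?_
    rw [Fintype.card_sigma]
    simp only [Fintype.card_fin]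
    rw [finrank_top, ← Fin.sum_univ_fun_getElem] at hL3
    exact hL3
  have hcard' : Fintype.card p.Box = Module.finrank F W := by
    refine le_antisymm hcard ?_
    have h1 := finrank_range_le_card (R := F) b
    rwa [Set.finrank, top_le_iff.mp hspan, finrank_top] at h1
  refine ⟨p, basisOfTopLeSpanOfCardEqFinrank b hspan hcard', ?_, ?_⟩
  · intro s
    rw [coe_basisOfTopLeSpanOfCardEqFinrank]
    exact pow_apply_mem_of_mem_nilpotentCone hx _
      (hg _ (lt_of_lt_of_le s.2.1 s.2.2))
  · intro s
    have h1 := s.2.1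
    have h2 := s.2.2
    rw [coe_basisOfTopLeSpanOfCardEqFinrank]
    change x ((x ^ (p.len s.1.1 - s.1.2)) (g s.1.1)) = _
    rw [← Module.End.mul_apply, ← pow_succ']
    by_cases h : s.1.2 = 1
    · rw [basisEntry_of_nonpos _ _ (by omega), show p.len s.1.1 - s.1.2 + 1 = p.len s.1.1 by omega,
        hg0]
    · obtain ⟨s', hs1, hs2⟩ := exists_box p (i := s.1.1) (j := (s.1.2 : ℤ) - 1) (by omega) (by omega)
      rw [← hs2, ← hs1, basisEntry_box, coe_basisOfTopLeSpanOfCardEqFinrank]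
      simp only [b]
      rw [hs1]
      congr 2
      omega

end Existence

/-! ### Orbits of marked Jordan bases -/

section Orbits

variable {n : ℕ} {F W : Type*} [Field F] [AddCommGroup W] [Module F W]
  {p : ColoredPartition n}

/-- The vector `∑ i, v_{i, μ i}`. -/
noncomputable def markVector (B : Module.Basis p.Box F W) (μ : ℕ → ℤ) : W :=
  ∑ i ∈ Finset.range p.length, basisEntry B i (μ i)

theorem basisCoord_markVector (B : Module.Basis p.Box F W) (μ : ℕ → ℤ) {i : ℕ} {j : ℤ}
    (h1 : 1 ≤ j) (h2 : j ≤ p.len i) :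
    basisCoord B i j (markVector B μ) = if j = μ i then 1 else 0 := by
  have hi : i ∈ Finset.range p.length :=
    Finset.mem_range.mpr ((p.lt_length_iff i).mpr (by omega))
  rw [markVector, map_sum, Finset.sum_eq_single_of_mem i hi]
  · rw [basisCoord_basisEntry]
    exact if_congr (by tauto) rfl rfl
  · intro i' _ hne
    rw [basisCoord_basisEntry, if_neg fun h => hne h.1.symm]

theorem basisEntry_map (B : Module.Basis p.Box F W) (k : W ≃ₗ[F] W) (i : ℕ) (j : ℤ) :
    basisEntry (B.map k) i j = k (basisEntry B i j) := by
  unfold basisEntry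
  split
  · rfl
  · rw [map_zero]

theorem markVector_map (B : Module.Basis p.Box F W) (k : W ≃ₗ[F] W) (μ : ℕ → ℤ) :
    markVector (B.map k) μ = k (markVector B μ) := by
  simp only [markVector, basisEntry_map, map_sum]

variable {V : ZMod n → Submodule F W} {x : Module.End F W} {B : Module.Basis p.Box F W}

theorem IsColoredJordanBasis.pow_markVector (hB : IsColoredJordanBasis V x B) {μ : ℕ → ℤ}
    (hμ : ∀ i, μ i ≤ p.len i) (k : ℕ) :
    (x ^ k) (markVector B μ) = markVector B fun i => μ i - k := by
  rw [markVector, map_sum]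
  exact Finset.sum_congr rfl fun i _ => hB.pow_apply_basisEntry i (hμ i) k

/-- Applying x^k moves every mark k steps to the left. A mark that falls off the row imposes no
condition; any other must have l boxes to its right. These are the orbit invariants that distinguish
markings. -/
theorem IsColoredJordanBasis.pow_markVector_mem_range_iff (hB : IsColoredJordanBasis V x B)
    {μ : ℕ → ℤ} (hμ : ∀ i, μ i ≤ p.len i) (k l : ℕ) :
    (x ^ k) (markVector B μ) ∈ LinearMap.range (x ^ l) ↔
      ∀ i, μ i ≤ k ∨ μ i - k + l ≤ p.len i := by
  rw [hB.pow_markVector hμ, hB.mem_range_pow_iff]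
  constructor
  · intro h i
    by_contra! hi
    have := hμ i
    have h0 := h i (μ i - k) (by omega) (by omega)
    rw [basisCoord_markVector B _ (by omega) (by omega), if_pos rfl] at h0
    exact one_ne_zero h0
  · intro h i j h1 h2
    by_cases h3 : j ≤ p.len i
    · rw [basisCoord_markVector B _ h1 h3, if_neg]
      rintro rfl
      have := h i
      omega
    · rw [basisCoord_eq_zero B (by omega), LinearMap.zero_apply]

theorem IsColoredJordanBasis.markVector_mem (hB : IsColoredJordanBasis V x B) {μ : ℕ → ℤ}
    {m : ZMod n} (h : ∀ i, 0 < μ i → p.color i + ((p.len i - μ i : ℤ) : ZMod n) = m) :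
    markVector B μ ∈ V m := by
  refine Submodule.sum_mem _ fun i _ => ?_
  by_cases hi : 0 < μ i
  · rw [← h i hi]
    exact hB.basisEntry_mem i (μ i)
  · rw [basisEntry_of_nonpos B i (by omega)]
    exact zero_mem _

theorem markVector_ne_zero (B : Module.Basis p.Box F W) {μ : ℕ → ℤ} {i : ℕ} (h1 : 0 < μ i)
    (h2 : μ i ≤ p.len i) : markVector B μ ≠ 0 := by
  intro h
  have := basisCoord_markVector B μ (by omega) h2
  rw [h, map_zero, if_pos rfl] at this
  exact zero_ne_one this

/-! ### The action of the color group and automorphisms commuting with `x`. -/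

theorem self_mem_enhancedOrbit (V : ZMod n → Submodule F W) (a : W × Module.End F W) :
    a ∈ enhancedOrbit V a :=
  ⟨1, one_mem _, by ext <;> rfl⟩

theorem enhancedOrbit_eq_of_mem {a b : W × Module.End F W} (h : a ∈ enhancedOrbit V b) :
    enhancedOrbit V a = enhancedOrbit V b := by
  have sub : ∀ {a b : W × Module.End F W}, a ∈ enhancedOrbit V b →
      enhancedOrbit V a ⊆ enhancedOrbit V b := by
    rintro _ b ⟨k, hk, rfl⟩ _ ⟨l, hl, rfl⟩
    exact ⟨l * k, mul_mem hl hk, by ext <;> rfl⟩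
  refine (sub h).antisymm (sub ?_)
  obtain ⟨k, hk, rfl⟩ := h
  refine ⟨k⁻¹, inv_mem hk, ?_⟩
  refine Prod.ext (k.symm_apply_apply _).symm (LinearMap.ext fun w => ?_)
  change b.2 w = k.symm (k (b.2 (k.symm (k w))))
  rw [k.symm_apply_apply, k.symm_apply_apply]

theorem apply_mem_of_mem_colorGroup {k : W ≃ₗ[F] W} (hk : k ∈ colorGroup V) {m : ZMod n} {w : W}
    (hw : w ∈ V m) : k w ∈ V m := by
  rw [← hk m]
  exact Submodule.mem_map_of_mem hw

theorem IsColoredJordanBasis.map (hB : IsColoredJordanBasis V x B) {k : W ≃ₗ[F] W}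
    (hk : k ∈ colorGroup V) : IsColoredJordanBasis V (k.conj x) (B.map k) := by
  refine ⟨fun b => apply_mem_of_mem_colorGroup hk (hB.1 b), fun b => ?_⟩
  rw [basisEntry_map, ← hB.2, Module.Basis.map_apply, LinearEquiv.conj_apply_apply,
    LinearEquiv.symm_apply_apply]

/-- The endomorphism commuting with `x` with prescribed values on the tops of the rows. -/
theorem IsColoredJordanBasis.exists_commuting (hV : DirectSum.IsInternal V)
    (hx : x ∈ nilpotentCone V) (hB : IsColoredJordanBasis V x B)
    (h : ℕ → W) (h0 : ∀ i, (x ^ p.len i) (h i) = 0) (hc : ∀ i, 0 < p.len i → h i ∈ V (p.color i)) :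
    ∃ T : Module.End F W, (∀ b : p.Box, T (B b) = (x ^ (p.len b.1.1 - b.1.2)) (h b.1.1)) ∧
      (∀ w, T (x w) = x (T w)) ∧ ∀ m, ∀ w ∈ V m, T w ∈ V m := by
  refine ⟨B.constr F fun b => (x ^ (p.len b.1.1 - b.1.2)) (h b.1.1), fun b => B.constr_basis F _ b,
    ?_, ?_⟩
  · suffices H : (B.constr F fun b => (x ^ (p.len b.1.1 - b.1.2)) (h b.1.1)) ∘ₗ x =
        x ∘ₗ (B.constr F fun b => (x ^ (p.len b.1.1 - b.1.2)) (h b.1.1)) from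
      fun w => LinearMap.congr_fun H w
    refine B.ext fun b => ?_
    have h1 := b.2.1
    have h2 := b.2.2
    rw [LinearMap.comp_apply, LinearMap.comp_apply, B.constr_basis, hB.2,
      ← Module.End.mul_apply, ← pow_succ']
    -- At the first box x v_{i,1} = 0, and commutation there is exactly the relation x^(λ i) h i =
    -- 0.
    by_cases hb : b.1.2 = 1
    · rw [basisEntry_of_nonpos B _ (by omega), map_zero,
        show p.len b.1.1 - b.1.2 + 1 = p.len b.1.1 by omega, h0]
    · obtain ⟨s, hs1, hs2⟩ := exists_box p (i := b.1.1) (j := (b.1.2 : ℤ) - 1) (by omega) (by omega)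
      rw [← hs2, ← hs1, basisEntry_box, B.constr_basis, hs1]
      congr 2
      omega
  · intro m w hw
    rw [eq_span_of_basis_mem hV.submodule_iSupIndep B p.boxColor hB.1 m] at hw
    have : Submodule.span F (B '' {b | p.boxColor b = m}) ≤
        (V m).comap (B.constr F fun b => (x ^ (p.len b.1.1 - b.1.2)) (h b.1.1)) := by
      rw [Submodule.span_le]
      rintro _ ⟨b, rfl, rfl⟩
      rw [SetLike.mem_coe, Submodule.mem_comap, B.constr_basis]
      exact pow_apply_mem_of_mem_nilpotentCone hx _ (hc _ (lt_of_lt_of_le b.2.1 b.2.2))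
    exact this hw

/-- The kernel of `T` is x-stable, and a nilpotent map on a nonzero space has a nonzero kernel. So
injectivity need only be tested on ker x, which is spanned by the first boxes of the rows. -/
theorem injective_of_commute_nilpotent (hx : IsNilpotent x) {T : Module.End F W}
    (hT : ∀ w, T (x w) = x (T w)) (hker : ∀ w, x w = 0 → T w = 0 → w = 0) :
    Function.Injective T := by
  classical
  rw [← LinearMap.ker_eq_bot, LinearMap.ker_eq_bot']
  have hpow : ∀ k w, T ((x ^ k) w) = (x ^ k) (T w) := by
    intro k
    induction k with
    | zero => simp
    | succ k ih =>
      intro w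
      rw [pow_succ', Module.End.mul_apply, Module.End.mul_apply, hT, ih]
  have key : ∀ k w, (x ^ k) w = 0 → T w = 0 → w = 0 := by
    intro k
    induction k with
    | zero =>
      intro w h _
      simpa using h
    | succ k ih =>
      intro w h hw
      refine ih w (hker _ ?_ ?_) hw
      · rw [← Module.End.mul_apply, ← pow_succ', h]
      · rw [hpow, hw, map_zero]
  obtain ⟨k, hk⟩ := hx
  exact fun w hw => key k w (by rw [hk, LinearMap.zero_apply]) hw

variable [FiniteDimensional F W]

theorem mem_colorGroup_of_apply_mem {k : W ≃ₗ[F] W} (h : ∀ m, ∀ w ∈ V m, k w ∈ V m) :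
    k ∈ colorGroup V := by
  intro m
  refine Submodule.eq_of_le_of_finrank_eq ?_ (LinearEquiv.finrank_map_eq k (V m))
  rintro _ ⟨w, hw, rfl⟩
  exact h m w hw

theorem mem_enhancedOrbit_of_commute (hx : IsNilpotent x) {T : Module.End F W}
    (hT : ∀ w, T (x w) = x (T w)) (hTV : ∀ m, ∀ w ∈ V m, T w ∈ V m)
    (hker : ∀ w, x w = 0 → T w = 0 → w = 0) (v : W) : (T v, x) ∈ enhancedOrbit V (v, x) := by
  let k : W ≃ₗ[F] W := LinearEquiv.ofInjectiveEndo T (injective_of_commute_nilpotent hx hT hker)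
  have hk : ∀ w, k w = T w := fun w => rfl
  refine ⟨k, mem_colorGroup_of_apply_mem hTV, Prod.ext rfl (LinearMap.ext fun w => ?_)⟩
  obtain ⟨w, rfl⟩ := k.surjective w
  simp only [LinearEquiv.conj_apply_apply, LinearEquiv.symm_apply_apply]
  rw [hk, hk, hT]

/-- The linear map matching the two bases box by box preserves colors, since the color of a box
depends only on the type. This is why Ψ is a single orbit, computable from any one basis (`Psi_eq`).
-/
theorem IsColoredJordanBasis.exists_mem_colorGroup (hV : DirectSum.IsInternal V)
    (hB : IsColoredJordanBasis V x B) {y : Module.End F W} {C : Module.Basis p.Box F W}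
    (hC : IsColoredJordanBasis V y C) :
    ∃ k ∈ colorGroup V, C = B.map k ∧ y = k.conj x := by
  let k : W ≃ₗ[F] W := B.equiv C (Equiv.refl _)
  have hCB : C = B.map k := by
    refine Module.Basis.eq_of_apply_eq fun b => ?_
    simp [k]
  have hk : k ∈ colorGroup V := by
    refine mem_colorGroup_of_apply_mem fun m w hw => ?_
    rw [eq_span_of_basis_mem hV.submodule_iSupIndep B p.boxColor hB.1 m] at hw
    have : Submodule.span F (B '' {b | p.boxColor b = m}) ≤ (V m).comap (k : W →ₗ[F] W) := by
      rw [Submodule.span_le]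
      rintro _ ⟨b, rfl, rfl⟩
      have h := hC.1 b
      rwa [hCB] at h
    exact this hw
  refine ⟨k, hk, hCB, C.ext fun b => ?_⟩
  have h := (hB.map hk).2 b
  rw [← hCB] at h
  rw [hC.2, h]

theorem Psi_eq (hV : DirectSum.IsInternal V) {q : MarkedColoredPartition n}
    {B : Module.Basis q.Box F W} (hx : x ∈ nilpotentCone V) (hB : IsColoredJordanBasis V x B) :
    Psi V q = enhancedOrbit V (markVector B q.mark, x) := by
  ext a
  constructor
  · rintro ⟨y, hy, C, hC, ha⟩
    obtain ⟨k, hk, rfl, rfl⟩ := hB.exists_mem_colorGroup hV hC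
    change a ∈ enhancedOrbit V (markVector (B.map k) q.mark, k.conj x) at ha
    have h : (markVector (B.map k) q.mark, k.conj x) ∈ enhancedOrbit V (markVector B q.mark, x) :=
      ⟨k, hk, by rw [markVector_map]⟩
    rwa [enhancedOrbit_eq_of_mem h] at ha
  · intro ha
    exact ⟨x, hx, B, hB, ha⟩

/-- A mark dominated by the mark of another row of the same color can be removed. -/
theorem IsColoredJordanBasis.mem_enhancedOrbit_update (hV : DirectSum.IsInternal V)
    (hx : x ∈ nilpotentCone V) (hB : IsColoredJordanBasis V x B) {μ : ℕ → ℤ}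
    (hμ : ∀ i, μ i ≤ p.len i) {i j : ℕ} (hij : i ≠ j) (h0 : 0 < μ i) (h1 : μ i ≤ μ j)
    (h2 : p.len j - μ j ≤ p.len i - μ i)
    (hc : p.color i + ((p.len i - μ i : ℤ) : ZMod n) =
      p.color j + ((p.len j - μ j : ℤ) : ZMod n)) :
    (markVector B μ, x) ∈ enhancedOrbit V (markVector B (Function.update μ i 0), x) := by
  classical
  have hi := hμ i
  have hj := hμ j
  -- The automorphism is the identity except on row j, where it adds a copy shifted into row i so
  -- that v_{j,μ j} goes to v_{j,μ j} + v_{i,μ i}. The target index is at most λ i by `h2`, and x^(λ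
  -- j) kills the added vector by `h1`.
  let h : ℕ → W := fun r => basisEntry B r (p.len r) +
    if r = j then basisEntry B i (p.len j + μ i - μ j) else 0
  have hpow : ∀ (r k : ℕ), (x ^ k) (h r) = basisEntry B r (p.len r - k) +
      if r = j then basisEntry B i (p.len j + μ i - μ j - k) else 0 := by
    intro r k
    simp only [h, map_add]
    rw [hB.pow_apply_basisEntry r le_rfl]
    split
    · rw [hB.pow_apply_basisEntry i (by omega)]
    · rw [map_zero]
  obtain ⟨T, hT1, hT2, hT3⟩ := hB.exists_commuting hV hx h (by
    intro r
    rw [hpow, basisEntry_of_nonpos B r (by omega), zero_add]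
    split
    · next hr => rw [basisEntry_of_nonpos B i (by rw [hr]; omega)]
    · rfl) (by
    intro r _
    refine Submodule.add_mem _ ?_ ?_
    · have := hB.basisEntry_mem r (p.len r)
      simpa using this
    · split
      · next hr =>
        subst hr
        have := hB.basisEntry_mem i (p.len r + μ i - μ r)
        have e : p.color i + ((p.len i - (p.len r + μ i - μ r) : ℤ) : ZMod n) = p.color r := by
          push_cast at hc ⊢
          linear_combination hc
        rwa [e] at this
      · exact zero_mem _)
  have hTB : ∀ (r : ℕ) (a : ℤ), 1 ≤ a → a ≤ p.len r → T (basisEntry B r a) =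
      basisEntry B r a + if r = j then basisEntry B i (a + μ i - μ j) else 0 := by
    intro r a ha1 ha2
    obtain ⟨b, rfl, rfl⟩ := exists_box p ha1 ha2
    rw [basisEntry_box, hT1, hpow, Nat.cast_sub (by omega), sub_sub_cancel, basisEntry_box]
    refine congrArg _ (if_ctx_congr Iff.rfl (fun hb => ?_) fun _ => rfl)
    rw [hb]
    congr 1
    ring
  have hTv : T (markVector B (Function.update μ i 0)) = markVector B μ := by
    have hmem : ∀ {r}, 0 < p.len r → r ∈ Finset.range p.length := fun {r} hr =>
      Finset.mem_range.mpr ((p.lt_length_iff r).mpr hr)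
    have e1 : T (markVector B (Function.update μ i 0)) = ∑ r ∈ Finset.range p.length,
        (basisEntry B r (Function.update μ i 0 r) +
          if r = j then basisEntry B i (μ i) else 0) := by
      rw [markVector, map_sum]
      refine Finset.sum_congr rfl fun r _ => ?_
      by_cases hr : 1 ≤ Function.update μ i 0 r
      · rw [hTB r _ hr]
        · refine congrArg _ (if_ctx_congr Iff.rfl (fun hrj => ?_) fun _ => rfl)
          rw [hrj, Function.update_of_ne hij.symm, add_sub_cancel_left]
        · by_cases hri : r = i
          · rw [hri, Function.update_self]
            omega
          · rw [Function.update_of_ne hri]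
            exact hμ r
      · rw [basisEntry_of_nonpos B r (by omega), map_zero, if_neg, add_zero]
        rintro rfl
        rw [Function.update_of_ne hij.symm] at hr
        omega
    have e2 : markVector B μ = ∑ r ∈ Finset.range p.length,
        (basisEntry B r (Function.update μ i 0 r) +
          if r = i then basisEntry B i (μ i) else 0) := by
      rw [markVector]
      refine Finset.sum_congr rfl fun r _ => ?_
      by_cases hri : r = i
      · rw [hri, Function.update_self, basisEntry_of_nonpos B i le_rfl, zero_add, if_pos rfl]
      · rw [Function.update_of_ne hri, if_neg hri, add_zero]
    rw [e1, e2, Finset.sum_add_distrib, Finset.sum_add_distrib, Finset.sum_ite_eq',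
      Finset.sum_ite_eq', if_pos (hmem (by omega)), if_pos (hmem (by omega))]
  rw [← hTv]
  refine mem_enhancedOrbit_of_commute hx.1 hT2 hT3 (fun w hxw hTw => ?_) _
  have := Fintype.ofFinite p.Box
  have hw2 := (hB.mem_ker_iff w).mp hxw
  -- On ker x the map is unipotent: it adds a multiple of a vector of row i, so the coordinate at
  -- (j, 1) is unchanged and must vanish when T w = 0.
  have hTw' : T w = w + basisCoord B j 1 w • basisEntry B i (1 + μ i - μ j) := by
    conv_lhs => rw [← sum_coord_smul_basis B w]
    rw [map_sum]
    have e : ∀ b : p.Box, T (basisCoord B b.1.1 b.1.2 w • B b) =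
        basisCoord B b.1.1 b.1.2 w • B b + if b.1 = (j, 1) then
          basisCoord B j 1 w • basisEntry B i (1 + μ i - μ j) else 0 := by
      intro b
      have hb1 := b.2.1
      have hb2 := b.2.2
      rw [map_smul, ← basisEntry_box, hTB _ _ (by omega) (by omega), smul_add]
      refine congrArg _ ?_
      by_cases hb : b.1.2 = 1
      · by_cases hbj : b.1.1 = j
        · rw [if_pos hbj, if_pos (Prod.ext hbj hb), hbj, hb]
          rfl
        · rw [if_neg hbj, smul_zero, if_neg fun h => hbj (by rw [h])]
      · rw [hw2 _ _ (by omega), zero_smul, if_neg fun h => hb (by rw [h])]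
    simp only [e]
    rw [Finset.sum_add_distrib, sum_coord_smul_basis]
    refine congrArg _ ?_
    rw [Finset.sum_eq_single ⟨(j, 1), le_rfl, by dsimp only; omega⟩]
    · rw [if_pos rfl]
    · intro b _ hb
      rw [if_neg fun h => hb (Subtype.ext h)]
    · simp
  rw [hTw] at hTw'
  have hw1 : basisCoord B j 1 w = 0 := by
    have := congrArg (basisCoord B j 1) hTw'
    rw [map_zero, map_add, map_smul, basisCoord_basisEntry, if_neg fun h => hij h.1.symm,
      smul_zero, add_zero] at this
    exact this.symm
  rw [hw1, zero_smul, add_zero] at hTw'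
  exact hTw'.symm

/-- Every homogeneous vector is in the orbit of a marking. -/
theorem IsColoredJordanBasis.exists_marking (hV : DirectSum.IsInternal V)
    (hx : x ∈ nilpotentCone V) (hB : IsColoredJordanBasis V x B) {m : ZMod n} {v : W}
    (hv : v ∈ V m) :
    ∃ μ : ℕ → ℤ, (∀ i, 0 ≤ μ i) ∧ (∀ i, μ i ≤ p.len i) ∧
      (∀ i, 0 < μ i → p.color i + ((p.len i - μ i : ℤ) : ZMod n) = m) ∧
      (v, x) ∈ enhancedOrbit V (markVector B μ, x) := by
  classical
  let c : ℕ → ℤ → F := fun i a => basisCoord B i a v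
  have hc : ∀ (i : ℕ) (a : ℤ), 1 ≤ a → a ≤ p.len i → c i a ≠ 0 →
      p.color i + ((p.len i - a : ℤ) : ZMod n) = m := by
    intro i a h1 h2 h3
    obtain ⟨b, rfl, rfl⟩ := exists_box p h1 h2
    by_contra hne
    refine h3 ((hB.mem_iff hV m v).mp hv b ?_)
    rw [ColoredPartition.boxColor, Nat.cast_sub b.2.2]
    push_cast at hne
    exact hne
  -- `M` is the last position of row i at which v has a nonzero coordinate, or 0 if the row does not
  -- meet v.
  have hmax : ∀ i, ∃ M : ℤ, 0 ≤ M ∧ M ≤ p.len i ∧ (0 < M → c i M ≠ 0) ∧ ∀ a, M < a → c i a = 0 := by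
    intro i
    have key : ∀ N : ℕ, (∀ a, (N : ℤ) < a → c i a = 0) →
        ∃ M : ℤ, 0 ≤ M ∧ M ≤ N ∧ (0 < M → c i M ≠ 0) ∧ ∀ a, M < a → c i a = 0 := by
      intro N
      induction N with
      | zero => exact fun h => ⟨0, le_rfl, le_rfl, fun h => absurd h (lt_irrefl _), h⟩
      | succ N ih =>
        intro h
        by_cases h0 : c i (N + 1 : ℕ) = 0
        · obtain ⟨M, hM1, hM2, hM3⟩ := ih fun a ha => by
            by_cases haN : a = (N + 1 : ℕ)
            · rw [haN, h0]
            · exact h a (by push_cast at haN ⊢; omega)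
          exact ⟨M, hM1, by push_cast; omega, hM3⟩
        · exact ⟨(N + 1 : ℕ), by omega, le_rfl, fun _ => h0, h⟩
    refine key (p.len i) fun a ha => ?_
    simp only [c]
    rw [basisCoord_eq_zero B (by omega), LinearMap.zero_apply]
  choose μ hμ0 hμ1 hμ2 hμ3 using hmax
  have hμc : ∀ i, 0 < μ i → p.color i + ((p.len i - μ i : ℤ) : ZMod n) = m := fun i hi =>
    hc i (μ i) hi (hμ1 i) (hμ2 i hi)
  refine ⟨μ, hμ0, hμ1, hμc, ?_⟩
  -- On row i the map `T` is the polynomial ∑ c_{i,a} x^(μ i - a), which turns v_{i,μ i} into the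
  -- component of v in that row; on the rows that v does not meet it is the identity.
  let h : ℕ → W := fun i => if μ i = 0 then basisEntry B i (p.len i) else
    ∑ a ∈ Finset.Icc 1 (μ i), c i a • basisEntry B i (a + p.len i - μ i)
  have hpow : ∀ (i k : ℕ), (x ^ k) (h i) = if μ i = 0 then basisEntry B i (p.len i - k) else
      ∑ a ∈ Finset.Icc 1 (μ i), c i a • basisEntry B i (a + p.len i - μ i - k) := by
    intro i k
    simp only [h]
    split
    · rw [hB.pow_apply_basisEntry i le_rfl]
    · rw [map_sum]
      refine Finset.sum_congr rfl fun a ha => ?_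
      have := (Finset.mem_Icc.mp ha).2
      rw [map_smul, hB.pow_apply_basisEntry i (by omega)]
  obtain ⟨T, hT1, hT2, hT3⟩ := hB.exists_commuting hV hx h (by
    intro i
    rw [hpow]
    split
    · rw [basisEntry_of_nonpos B i (by omega)]
    · refine Finset.sum_eq_zero fun a ha => ?_
      have := (Finset.mem_Icc.mp ha).2
      rw [basisEntry_of_nonpos B i (by omega), smul_zero]) (by
    intro i _
    simp only [h]
    split
    · have := hB.basisEntry_mem i (p.len i)
      simpa using this
    · next hi =>
      refine Submodule.sum_mem _ fun a ha => ?_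
      obtain ⟨ha1, ha2⟩ := Finset.mem_Icc.mp ha
      by_cases hca : c i a = 0
      · rw [hca, zero_smul]
        exact zero_mem _
      · refine Submodule.smul_mem _ _ ?_
        have h1 := hc i a ha1 (ha2.trans (hμ1 i)) hca
        have h2 := hμc i (lt_of_le_of_ne (hμ0 i) (Ne.symm hi))
        have h3 := hB.basisEntry_mem i (a + p.len i - μ i)
        -- The boxes at a and at μ i both have color m, so μ i - a is 0 modulo n and the shift
        -- preserves colors.
        have e : p.color i + ((p.len i - (a + p.len i - μ i) : ℤ) : ZMod n) = p.color i := by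
          push_cast at h1 h2 ⊢
          linear_combination h1 - h2
        rwa [e] at h3)
  have hTB : ∀ (i : ℕ) (a : ℤ), 1 ≤ a → a ≤ p.len i → T (basisEntry B i a) =
      if μ i = 0 then basisEntry B i a else
        ∑ a' ∈ Finset.Icc 1 (μ i), c i a' • basisEntry B i (a' - μ i + a) := by
    intro i a ha1 ha2
    obtain ⟨b, rfl, rfl⟩ := exists_box p ha1 ha2
    rw [basisEntry_box, hT1, hpow, Nat.cast_sub (by omega), sub_sub_cancel, basisEntry_box]
    refine if_congr Iff.rfl rfl (Finset.sum_congr rfl fun a' _ => ?_)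
    congr 2
    ring
  have hTv : T (markVector B μ) = v := by
    have e1 : T (markVector B μ) = ∑ i ∈ Finset.range p.length,
        ∑ a ∈ Finset.Icc 1 (μ i), c i a • basisEntry B i a := by
      rw [markVector, map_sum]
      refine Finset.sum_congr rfl fun i _ => ?_
      by_cases hi : μ i = 0
      · rw [hi, basisEntry_of_nonpos B i le_rfl, map_zero]
        rfl
      · have := hμ0 i
        rw [hTB i _ (by omega) (hμ1 i), if_neg hi]
        refine Finset.sum_congr rfl fun a _ => ?_
        rw [sub_add_cancel]
    rw [e1]
    refine basisCoord_ext B fun i j hj1 hj2 => ?_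
    have hi : i ∈ Finset.range p.length :=
      Finset.mem_range.mpr ((p.lt_length_iff i).mpr (by omega))
    rw [map_sum, Finset.sum_eq_single_of_mem i hi]
    · rw [map_sum]
      by_cases hj : j ≤ μ i
      · rw [Finset.sum_eq_single_of_mem j (Finset.mem_Icc.mpr ⟨hj1, hj⟩)]
        · rw [map_smul, basisCoord_basisEntry, if_pos ⟨rfl, rfl, hj1, hj2⟩, smul_eq_mul, mul_one]
        · intro a _ ha
          rw [map_smul, basisCoord_basisEntry, if_neg fun h => ha h.2.1.symm, smul_zero]
      · rw [show basisCoord B i j v = 0 from hμ3 i j (by omega)]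
        refine Finset.sum_eq_zero fun a ha => ?_
        have := (Finset.mem_Icc.mp ha).2
        rw [map_smul, basisCoord_basisEntry, if_neg (by omega), smul_zero]
    · intro i' _ hne
      rw [map_sum]
      refine Finset.sum_eq_zero fun a _ => ?_
      rw [map_smul, basisCoord_basisEntry, if_neg fun h => hne h.1.symm, smul_zero]
  rw [← hTv]
  refine mem_enhancedOrbit_of_commute hx.1 hT2 hT3 (fun w hxw hTw => ?_) _
  have := Fintype.ofFinite p.Box
  have hw2 := (hB.mem_ker_iff w).mp hxw
  -- On ker x the map is diagonal: on v_{i,1} only the constant term of the polynomial survives, the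
  -- nonzero coefficient of v at μ i.
  let u : ℕ → F := fun i => if μ i = 0 then 1 else c i (μ i)
  have hu : ∀ i, u i ≠ 0 := by
    intro i
    simp only [u]
    split
    · exact one_ne_zero
    · next hi => exact hμ2 i (lt_of_le_of_ne (hμ0 i) (Ne.symm hi))
  have hT1 : ∀ b : p.Box, b.1.2 = 1 → T (B b) = u b.1.1 • B b := by
    intro b hb
    have hb2 := b.2.2
    have := hμ0 b.1.1
    rw [← basisEntry_box, hTB _ _ (by omega) (by omega), hb]
    simp only [u]
    split
    · rw [one_smul]
    · rw [Finset.sum_eq_single_of_mem (μ b.1.1) (Finset.mem_Icc.mpr ⟨by omega, le_rfl⟩)]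
      · rw [sub_self, zero_add]
      · intro a ha hne
        have := (Finset.mem_Icc.mp ha).2
        rw [basisEntry_of_nonpos B _ (by omega), smul_zero]
  have hsum : ∑ b : p.Box, (basisCoord B b.1.1 b.1.2 w * u b.1.1) • B b = 0 := by
    rw [← hTw]
    conv_rhs => rw [← sum_coord_smul_basis B w, map_sum]
    refine Finset.sum_congr rfl fun b _ => ?_
    have hb1 := b.2.1
    by_cases hb : b.1.2 = 1
    · rw [map_smul, hT1 b hb, mul_smul]
    · rw [hw2 _ _ (by omega), zero_mul, zero_smul, map_zero]
  have hz := Fintype.linearIndependent_iff.mp B.linearIndependent _ hsum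
  rw [← sum_coord_smul_basis B w]
  exact Finset.sum_eq_zero fun b _ => by
    rw [(mul_eq_zero.mp (hz b)).resolve_right (hu _), zero_smul]

end Orbits

/-! ### Strictly decreasing marks -/

section StrictMarks

variable {n : ℕ}

/-- The marks are nonnegative, and any two rows with positive marks have the same mark color and
are strictly comparable with respect to both the mark and the rest of the row. -/
def StrictMarks {ι : Type*} (r : ι → ℕ × ZMod n × ℤ) : Prop :=
  (∀ i, 0 ≤ (r i).2.2) ∧ ∀ i j, i ≠ j → 0 < (r i).2.2 → 0 < (r j).2.2 →
    (r i).2.1 + (((r i).1 - (r i).2.2 : ℤ) : ZMod n) =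
      (r j).2.1 + (((r j).1 - (r j).2.2 : ℤ) : ZMod n) ∧
    (((r j).2.2 < (r i).2.2 ∧ (r j).1 - (r j).2.2 < (r i).1 - (r i).2.2) ∨
      ((r i).2.2 < (r j).2.2 ∧ (r i).1 - (r i).2.2 < (r j).1 - (r j).2.2))

theorem StrictMarks.comp {ι κ : Type*} {r : ι → ℕ × ZMod n × ℤ} (h : StrictMarks r) {e : κ → ι}
    (he : Function.Injective e) : StrictMarks (r ∘ e) :=
  ⟨fun i => h.1 (e i), fun _ _ hij => h.2 _ _ (he.ne hij)⟩

/-- The comparison involves only positive marks, so unmarked rows can be added freely. -/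
theorem StrictMarks.interlace {f g : ℕ → ℕ × ZMod n × ℤ} (hf : StrictMarks f)
    (hg : ∀ i, (g i).2.2 = 0) : StrictMarks (interlace f g) := by
  rw [interlace_eq]
  refine StrictMarks.comp ⟨?_, ?_⟩ (Equiv.injective _)
  · rintro (i | i)
    · exact (hg i).ge
    · exact hf.1 i
  · rintro (i | i) (j | j) hij hi hj
    · exact absurd (hg i) hi.ne'
    · exact absurd (hg i) hi.ne'
    · exact absurd (hg j) hj.ne'
    · exact hf.2 i j (fun h => hij (by rw [h])) hi hj

end StrictMarks

/-- The colored partition `(λ, ε)` with the zero marking. -/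
def ColoredPartition.unmarked {n : ℕ} (p : ColoredPartition n) : MarkedColoredPartition n :=
  ⟨p, 0, fun _ => by simp⟩

/-- Every signature is the signature of a colored partition. -/
theorem ColoredPartition.exists_signature_eq {n : ℕ} [NeZero n] (f : ZMod n → ℕ) :
    ∃ p : ColoredPartition n, p.signature = f := by
  -- Rows of length 1 suffice: f m of them with color m.
  obtain ⟨p, e, he⟩ := exists_row_eq (fun s : Σ m, Fin (f m) => ((1 : ℕ), s.1))
  have hl : ∀ s, p.len (e.symm (Sum.inl s)) = 1 := fun s => by
    have := congrArg Prod.fst (congrFun he (e.symm (Sum.inl s)))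
    simpa [row] using this
  have hc : ∀ s, p.color (e.symm (Sum.inl s)) = s.1 := fun s => by
    have := congrArg Prod.snd (congrFun he (e.symm (Sum.inl s)))
    simpa [row] using this
  have hr : ∀ s, p.len (e.symm (Sum.inr s)) = 0 := fun s => by
    have := congrArg Prod.fst (congrFun he (e.symm (Sum.inr s)))
    simpa [row] using this
  refine ⟨p, funext fun m => ?_⟩
  let g : Fin (f m) → {b : p.Box // p.boxColor b = m} := fun k =>
    ⟨⟨(e.symm (Sum.inl ⟨m, k⟩), 1), le_rfl, by dsimp only; rw [hl]⟩, by
      simp only [boxColor, hl, hc, Nat.sub_self, Nat.cast_zero, add_zero]⟩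
  have hg : Function.Bijective g := by
    constructor
    · intro k k' h
      have h1 : e.symm (Sum.inl ⟨m, k⟩) = e.symm (Sum.inl ⟨m, k'⟩) :=
        congrArg (fun b => b.1.1.1) h
      simpa using h1
    · rintro ⟨⟨⟨i, j⟩, h1, h2⟩, h3⟩
      obtain ⟨s, rfl⟩ := e.symm.surjective i
      simp only at h1 h2
      rcases s with ⟨m', k⟩ | s
      · have hj : j = 1 := by
          rw [hl] at h2
          omega
        subst hj
        have hm : m' = m := by
          simpa only [boxColor, hl, hc, Nat.sub_self, Nat.cast_zero, add_zero] using h3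
        subst hm
        exact ⟨k, rfl⟩
      · rw [hr] at h2
        omega
  rw [signature, ← Nat.card_eq_of_bijective g hg, Nat.card_fin]

/-! ### Separating marked rows from unmarked rows. -/

namespace MarkedColoredPartition

variable {n : ℕ}

theorem rowCount_unmarked (d : ColoredPartition n) (t : ℕ × ZMod n × ℤ) (ht : t.2.2 ≠ 0) :
    rowCount d.unmarked.row t = 0 := by
  rw [rowCount_eq_zero_iff]
  rintro i rfl
  exact ht rfl

theorem rowCount_row_zero (p : MarkedColoredPartition n) (h0 : ∀ i, p.len i = 0 → p.mark i = 0)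
    (c : ZMod n) : rowCount p.row (0, c, 0) = ⊤ := by
  rw [rowCount, Set.encard_eq_top_iff]
  refine ((p.infinite_color c).sdiff p.finite_support).mono ?_
  rintro i ⟨h1, h2⟩
  simp only [Set.mem_ofPred_eq, not_lt, nonpos_iff_eq_zero] at h1 h2
  simp [row, h1, h2, h0 i h2]

theorem rowCount_deleteUnmarked_of_ne (p : MarkedColoredPartition n) {t : ℕ × ZMod n × ℤ}
    (ht : ¬ (0 < t.1 ∧ t.2.2 = 0)) : rowCount p.deleteUnmarked.row t = rowCount p.row t := by
  rw [deleteUnmarked, rowCount_deleteRows, rowCount]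
  congr 1
  ext i
  simp only [Set.mem_ofPred_eq, and_iff_right_iff_imp]
  rintro rfl
  exact ht

theorem rowCount_deleteUnmarked_eq_zero (p : MarkedColoredPartition n) {t : ℕ × ZMod n × ℤ}
    (ht : 0 < t.1 ∧ t.2.2 = 0) : rowCount p.deleteUnmarked.row t = 0 := by
  rw [deleteUnmarked, rowCount_deleteRows, Set.encard_eq_zero, Set.eq_empty_iff_forall_notMem]
  rintro i ⟨h1, rfl⟩
  exact h1 ht

/-- Adding unmarked rows to a partition all of whose nonzero rows are marked, and deleting the
unmarked rows, gives back the partition. -/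
theorem rowEquiv_deleteUnmarked_union (p : MarkedColoredPartition n) (d : ColoredPartition n)
    (hpos : ∀ i, 0 < p.len i → 0 < p.mark i) (h0 : ∀ i, p.len i = 0 → p.mark i = 0) :
    p.RowEquiv (p.union d.unmarked).deleteUnmarked := by
  rw [rowEquiv_iff]
  funext t
  by_cases ht : 0 < t.1 ∧ t.2.2 = 0
  · rw [rowCount_deleteUnmarked_eq_zero _ ht, rowCount_eq_zero_iff]
    rintro i rfl
    exact absurd ht.2 (hpos i ht.1).ne'
  · rw [rowCount_deleteUnmarked_of_ne _ ht, rowCount_row_union]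
    by_cases hm : t.2.2 = 0
    · obtain ⟨l, c, m⟩ := t
      obtain rfl : l = 0 := by
        simp only at ht hm
        omega
      obtain rfl : m = 0 := hm
      rw [rowCount_row_zero p h0, top_add]
    · rw [rowCount_unmarked d t hm, add_zero]

/-- The rows of `p` that are empty or unmarked, as a colored partition. -/
noncomputable def unmarkedPart (p : MarkedColoredPartition n) : ColoredPartition n :=
  (p.deleteRows {i | 0 < p.len i ∧ p.mark i ≠ 0}
    (p.finite_support.subset fun _ hi => hi.1)).toColoredPartition

/-- Every nonempty row goes to exactly one of the two parts. The empty rows are kept by both, but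
their multiplicities are infinite, so counting them twice is harmless. -/
theorem union_unmarkedPart_rowEquiv (p : MarkedColoredPartition n)
    (h0 : ∀ i, p.len i = 0 → p.mark i = 0) :
    (p.deleteUnmarked.union p.unmarkedPart.unmarked).RowEquiv p := by
  rw [rowEquiv_iff]
  funext t
  rw [rowCount_row_union]
  by_cases ht : 0 < t.1 ∧ t.2.2 = 0
  · rw [rowCount_deleteUnmarked_eq_zero _ ht, zero_add]
    obtain ⟨l, c, m⟩ := t
    obtain ⟨hl, rfl⟩ := ht
    have h1 : rowCount p.unmarkedPart.unmarked.row (l, c, 0) =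
        rowCount p.unmarkedPart.row (l, c) := by
      simp [rowCount, row, ColoredPartition.row, ColoredPartition.unmarked]
    have h2 : p.unmarkedPart.row = p.toColoredPartition.row ∘
        Nat.nth (· ∉ {i | 0 < p.len i ∧ p.mark i ≠ 0}) := rfl
    rw [h1, h2, rowCount_comp_nth _ (p.finite_support.subset fun _ hi => hi.1), rowCount]
    congr 1
    ext i
    simp only [Set.mem_ofPred_eq, row, ColoredPartition.row, Prod.mk.injEq]
    constructor
    · rintro ⟨h3, rfl, rfl⟩
      refine ⟨rfl, rfl, ?_⟩
      by_contra h
      exact h3 ⟨hl, h⟩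
    · rintro ⟨rfl, rfl, h⟩
      exact ⟨fun h' => h'.2 h, rfl, rfl⟩
  · rw [rowCount_deleteUnmarked_of_ne _ ht]
    by_cases hm : t.2.2 = 0
    · obtain ⟨l, c, m⟩ := t
      obtain rfl : l = 0 := by
        simp only at ht hm
        omega
      obtain rfl : m = 0 := hm
      rw [rowCount_row_zero p h0, top_add]
    · rw [rowCount_unmarked _ t hm, add_zero]

theorem not_mem_deleteUnmarked (p : MarkedColoredPartition n) (k : ℕ) :
    ¬ (0 < p.deleteUnmarked.len k ∧ p.deleteUnmarked.mark k = 0) := by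
  have hinf : {i | i ∉ {i | 0 < p.len i ∧ p.mark i = 0}}.Infinite :=
    (p.finite_support.subset fun _ (hi : _ ∈ {i | 0 < p.len i ∧ p.mark i = 0}) =>
      hi.1).infinite_compl
  exact Nat.nth_mem_of_infinite (p := (· ∉ {i | 0 < p.len i ∧ p.mark i = 0})) hinf k

theorem strictMarks_deleteUnmarked {p : MarkedColoredPartition n} (h : StrictMarks p.row) :
    StrictMarks p.deleteUnmarked.row :=
  h.comp (Nat.nth_strictMono ((p.finite_support.subset fun _
    (hi : _ ∈ {i | 0 < p.len i ∧ p.mark i = 0}) => hi.1).infinite_compl)).injective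

theorem strictMarks_union_unmarked {p : MarkedColoredPartition n} (h : StrictMarks p.row)
    (d : ColoredPartition n) : StrictMarks (p.union d.unmarked).row := by
  obtain ⟨σ, hσ⟩ := exists_row_union p d.unmarked
  rw [hσ]
  exact (h.interlace fun _ => rfl).comp σ.injective

/-- The order-independent form of the conditions on a characteristic colored bipartition. -/
theorem strictMarks_iff (p : MarkedColoredPartition n) :
    ((∀ i, i < p.length → 0 < p.mark i) ∧ (∀ i, p.length ≤ i → p.mark i = 0) ∧
      (∀ i j, i < j → j < p.length → p.markColor i = p.markColor j ∧
        p.mark j < p.mark i ∧ p.len j - p.mark j < p.len i - p.mark i)) ↔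
    StrictMarks p.row ∧ (∀ i, 0 < p.len i → 0 < p.mark i) ∧ ∀ i, p.len i = 0 → p.mark i = 0 := by
  have hlen := p.lt_length_iff
  have hlen' : ∀ i, p.length ≤ i ↔ p.len i = 0 := fun i => by
    have := hlen i
    omega
  simp only [hlen, hlen']
  constructor
  · rintro ⟨h1, h2, h3⟩
    have hpos : ∀ i, 0 < p.mark i → 0 < p.len i := fun i hi => by
      by_contra h
      have := h2 i (by omega)
      omega
    refine ⟨⟨fun i => ?_, fun i j hij hi hj => ?_⟩, h1, h2⟩
    · rcases Nat.eq_zero_or_pos (p.len i) with h | h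
      · exact (h2 i h).ge
      · exact (h1 i h).le
    · rcases lt_or_gt_of_ne hij with h | h
      · obtain ⟨h4, h5⟩ := h3 i j h (hpos j hj)
        exact ⟨h4, Or.inl h5⟩
      · obtain ⟨h4, h5⟩ := h3 j i h (hpos i hi)
        exact ⟨h4.symm, Or.inr h5⟩
  · rintro ⟨⟨h1, h2⟩, h3, h4⟩
    refine ⟨h3, h4, fun i j hij hj => ?_⟩
    -- The lengths decrease, so row j cannot exceed row i both in its mark and in its rest; only one
    -- alternative of strict comparability survives.
    have hl := p.antitone_len hij.le
    obtain ⟨h5, h6⟩ := h2 i j hij.ne (h3 i (by omega)) (h3 j hj)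
    refine ⟨h5, ?_⟩
    simp only [row] at h6
    omega

end MarkedColoredPartition

/-! ### Minimal markings and orbit invariants -/

section Minimal

variable {n : ℕ} {F W : Type*} [Field F] [AddCommGroup W] [Module F W]
  {V : ZMod n → Submodule F W} {x : Module.End F W}

theorem pow_mem_range_iff_of_mem_enhancedOrbit {y : Module.End F W} {v w : W}
    (h : (v, x) ∈ enhancedOrbit V (w, y)) (a l : ℕ) :
    (x ^ a) v ∈ LinearMap.range (x ^ l) ↔ (y ^ a) w ∈ LinearMap.range (y ^ l) := by
  obtain ⟨k, -, h⟩ := h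
  obtain ⟨rfl, rfl⟩ := Prod.mk.inj h
  have hpow : ∀ (a : ℕ) u, (k.conj y ^ a) (k u) = k ((y ^ a) u) := by
    intro a
    induction a with
    | zero => exact fun u => rfl
    | succ a ih =>
      intro u
      rw [pow_succ, pow_succ, Module.End.mul_apply, Module.End.mul_apply, ← ih,
        LinearEquiv.conj_apply_apply, k.symm_apply_apply]
  rw [hpow]
  constructor
  · rintro ⟨u, hu⟩
    obtain ⟨u, rfl⟩ := k.surjective u
    rw [hpow] at hu
    exact ⟨u, k.injective hu⟩
  · rintro ⟨u, hu⟩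
    exact ⟨k u, by rw [hpow, hu]⟩

theorem IsColoredJordanBasis.strictMarks_mem {q : MarkedColoredPartition n}
    {B : Module.Basis q.Box F W} (hB : IsColoredJordanBasis V x B) (hq : StrictMarks q.row)
    {i : ℕ} (hi : 0 < q.mark i) : markVector B q.mark ∈ V (q.markColor i) := by
  refine hB.markVector_mem fun j hj => ?_
  by_cases hij : i = j
  · rw [hij]
    rfl
  · exact (hq.2 i j hij hi hj).1.symm

/-- The rows with positive mark are determined by the orbit. -/
theorem IsColoredJordanBasis.exists_mark_iff {q : MarkedColoredPartition n}
    {B : Module.Basis q.Box F W} (hB : IsColoredJordanBasis V x B) (hq : StrictMarks q.row)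
    (l m : ℕ) :
    (∃ i, q.len i = l + 1 ∧ q.mark i = m + 1) ↔
      (x ^ m) (markVector B q.mark) ∉ LinearMap.range (x ^ (l + 1)) ∧
      (x ^ m) (markVector B q.mark) ∈ LinearMap.range (x ^ l) ∧
      (x ^ (m + 1)) (markVector B q.mark) ∈ LinearMap.range (x ^ (l + 2)) := by
  rw [hB.pow_markVector_mem_range_iff q.mark_le, hB.pow_markVector_mem_range_iff q.mark_le,
    hB.pow_markVector_mem_range_iff q.mark_le]
  constructor
  · rintro ⟨i, h1, h2⟩
    -- Row i has rest l - m, so any other marked row lies strictly below it or strictly above it in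
    -- both coordinates. This makes row i a corner of the staircase.
    have key : ∀ j, j ≠ i → q.mark j ≤ m ∨
        (m + 1 < q.mark j ∧ (l : ℤ) - m < q.len j - q.mark j) := by
      intro j hj
      by_cases h : 0 < q.mark j
      · have := (hq.2 j i hj h (by simp only [MarkedColoredPartition.row]; omega)).2
        simp only [MarkedColoredPartition.row] at this
        omega
      · omega
    refine ⟨fun h => ?_, fun j => ?_, fun j => ?_⟩
    · have := h i
      push_cast at this
      omega
    · by_cases hj : j = i
      · subst hj
        omega
      · have := key j hj
        omega
    · by_cases hj : j = i
      · subst hj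
        push_cast
        omega
      · have := key j hj
        push_cast
        omega
  · rintro ⟨h1, h2, h3⟩
    push Not at h1
    obtain ⟨i, h4, h5⟩ := h1
    have h6 := h2 i
    have h7 := h3 i
    push_cast at h4 h5 h6 h7
    -- The first two conditions force λ i - μ i = l - m; the third excludes μ i > m + 1.
    exact ⟨i, by omega, by omega⟩

/-- Length and mark come from the staircase. The common vector is nonzero and homogeneous, so it has
one color, which is the mark color in both partitions and determines the color of the row. -/
theorem IsColoredJordanBasis.exists_row_eq (hV : DirectSum.IsInternal V)
    {q q' : MarkedColoredPartition n} {B : Module.Basis q.Box F W} {C : Module.Basis q'.Box F W}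
    (hB : IsColoredJordanBasis V x B) (hC : IsColoredJordanBasis V x C)
    (hq : StrictMarks q.row) (hq' : StrictMarks q'.row)
    (h : markVector B q.mark = markVector C q'.mark) {t : ℕ × ZMod n × ℤ} (ht : 0 < t.2.2)
    (hi : ∃ i, q.row i = t) : ∃ i, q'.row i = t := by
  obtain ⟨i, rfl⟩ := hi
  simp only [MarkedColoredPartition.row] at ht
  have hmi := q.mark_le i
  obtain ⟨m, hm⟩ : ∃ m : ℕ, q.mark i = m + 1 := ⟨(q.mark i - 1).toNat, by omega⟩
  obtain ⟨l, hl⟩ : ∃ l : ℕ, q.len i = l + 1 := ⟨q.len i - 1, by omega⟩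
  have h1 := (hB.exists_mark_iff hq l m).mp ⟨i, hl, hm⟩
  rw [h] at h1
  obtain ⟨j, hj1, hj2⟩ := (hC.exists_mark_iff hq' l m).mpr h1
  refine ⟨j, ?_⟩
  have hv1 := hB.strictMarks_mem hq ht
  have hv2 := hC.strictMarks_mem hq' (i := j) (by omega)
  rw [← h] at hv2
  have hcol : q.markColor i = q'.markColor j := by
    by_contra hne
    refine markVector_ne_zero B ht hmi ?_
    exact Submodule.disjoint_def.mp (hV.submodule_iSupIndep.pairwiseDisjoint hne) _ hv1 hv2
  rw [MarkedColoredPartition.markColor, MarkedColoredPartition.markColor, hl, hm, hj1, hj2] at hcol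
  simp only [MarkedColoredPartition.row, hl, hm, hj1, hj2, add_right_cancel hcol]

variable [FiniteDimensional F W]

/-- If the mark of row i is lowered, x^(μ i - 1) v enters im x^(λ i), which it did not meet before:
any other row still marked beyond μ i - 1 has a strictly larger rest. An orbit invariant has
changed. -/
theorem isMinimalMarking_of_strictMarks (hV : DirectSum.IsInternal V)
    {q : MarkedColoredPartition n} (hsig : q.signature = spaceSignature V)
    (hq : StrictMarks q.row) : IsMinimalMarking V q := by
  refine ⟨hsig, hq.1, fun δ h hδ0 hδ hPsi => ?_⟩
  obtain ⟨x, hx, B, hB⟩ := exists_isColoredJordanBasis_of_signature hV q.toColoredPartition hsig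
  rw [Psi_eq hV (q := q.withMark δ h) hx hB, Psi_eq hV hx hB] at hPsi
  have hmem : (markVector B δ, x) ∈ enhancedOrbit V (markVector B q.mark, x) :=
    hPsi ▸ self_mem_enhancedOrbit V _
  by_contra hne
  obtain ⟨i, hi⟩ := Function.ne_iff.mp hne
  have hi' : δ i < q.mark i := lt_of_le_of_ne (hδ i) hi
  have hi0 : 0 ≤ δ i := hδ0 i
  obtain ⟨a, ha⟩ : ∃ a : ℕ, q.mark i = a + 1 := ⟨(q.mark i - 1).toNat, by omega⟩
  have key := pow_mem_range_iff_of_mem_enhancedOrbit hmem a (q.len i)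
  rw [hB.pow_markVector_mem_range_iff h, hB.pow_markVector_mem_range_iff q.mark_le] at key
  have := key.mp (fun r => by
    by_cases hr : r = i
    · left
      rw [hr]
      omega
    · by_cases hra : δ r ≤ a
      · exact Or.inl hra
      · right
        have h1 : δ r ≤ q.mark r := hδ r
        have h2 := (hq.2 r i hr (by simp only [MarkedColoredPartition.row]; omega)
          (by simp only [MarkedColoredPartition.row]; omega)).2
        simp only [MarkedColoredPartition.row] at h2
        omega) i
  omega

/-- If the marks are not strictly comparable, then a mark can be removed. -/
theorem exists_update_of_not_strictMarks (hV : DirectSum.IsInternal V)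
    (hx : x ∈ nilpotentCone V) {q : MarkedColoredPartition n} {B : Module.Basis q.Box F W}
    (hB : IsColoredJordanBasis V x B) (h0 : ∀ i, 0 ≤ q.mark i)
    (hc : ∀ i j, 0 < q.mark i → 0 < q.mark j → q.markColor i = q.markColor j)
    (hq : ¬ StrictMarks q.row) :
    ∃ i, 0 < q.mark i ∧ (markVector B q.mark, x) ∈
      enhancedOrbit V (markVector B (Function.update q.mark i 0), x) := by
  by_contra! hno
  refine hq ⟨h0, fun i j hij hi hj => ⟨hc i j hi hj, ?_⟩⟩
  simp only [MarkedColoredPartition.row] at hi hj ⊢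
  by_contra! hcmp
  -- When strict comparability fails, one of the two rows has a weakly smaller mark and a weakly
  -- larger rest, and its mark is the removable one.
  by_cases h : q.mark i ≤ q.mark j ∧ (q.len j : ℤ) - q.mark j ≤ q.len i - q.mark i
  · exact hno i hi (hB.mem_enhancedOrbit_update hV hx q.mark_le hij hi h.1 h.2 (hc i j hi hj))
  · refine hno j hj (hB.mem_enhancedOrbit_update hV hx q.mark_le hij.symm hj ?_ ?_ (hc j i hj hi))
    · omega
    · omega

theorem strictMarks_of_isMinimalMarking (hV : DirectSum.IsInternal V)
    {q : MarkedColoredPartition n} (hq : IsMinimalMarking V q)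
    (hc : ∀ i j, 0 < q.mark i → 0 < q.mark j → q.markColor i = q.markColor j) :
    StrictMarks q.row := by
  obtain ⟨hsig, h0, hmin⟩ := hq
  obtain ⟨x, hx, B, hB⟩ := exists_isColoredJordanBasis_of_signature hV q.toColoredPartition hsig
  by_contra hns
  obtain ⟨i, hi, hmem⟩ := exists_update_of_not_strictMarks hV hx hB h0 hc hns
  have hle : Function.update q.mark i 0 ≤ q.mark := by
    rw [update_le_iff]
    exact ⟨hi.le, fun _ _ => le_rfl⟩
  have h0' : 0 ≤ Function.update q.mark i 0 := by
    rw [le_update_iff]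
    exact ⟨le_rfl, fun r _ => h0 r⟩
  have := hmin (Function.update q.mark i 0) (fun r => (hle r).trans (q.mark_le r)) h0' hle (by
    rw [Psi_eq hV (q := q.withMark (Function.update q.mark i 0) _) hx hB, Psi_eq hV hx hB]
    exact (enhancedOrbit_eq_of_mem hmem).symm)
  have h1 := congrFun this i
  rw [Function.update_self] at h1
  omega

/-- Every point with a homogeneous vector lies in the orbit of strictly comparable marks. -/
theorem exists_strictMarks [NeZero n] (hV : DirectSum.IsInternal V) (hx : x ∈ nilpotentCone V)
    {m : ZMod n} {v : W} (hv : v ∈ V m) :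
    ∃ q : MarkedColoredPartition n, q.signature = spaceSignature V ∧ StrictMarks q.row ∧
      Psi V q = enhancedOrbit V (v, x) := by
  obtain ⟨p, B, hB⟩ := exists_isColoredJordanBasis hV hx
  let S : Set (ℕ → ℤ) := {μ | (∀ i, 0 ≤ μ i) ∧ (∀ i, μ i ≤ p.len i) ∧
      (∀ i, 0 < μ i → p.color i + ((p.len i - μ i : ℤ) : ZMod n) = m) ∧
      (v, x) ∈ enhancedOrbit V (markVector B μ, x)}
  -- Among the markings that represent the orbit, one of least total mark admits no removal, so it
  -- is strict.
  obtain ⟨μ, ⟨h0, h1, h2, h3⟩, hmin⟩ := (measure fun μ : ℕ → ℤ =>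
    ∑ i ∈ Finset.range p.length, (μ i).toNat).wf.has_min S (hB.exists_marking hV hx hv)
  let q : MarkedColoredPartition n := ⟨p, μ, h1⟩
  refine ⟨q, hB.signature_eq hV, ?_, ?_⟩
  · by_contra hns
    obtain ⟨i, hi, hmem⟩ := exists_update_of_not_strictMarks (q := q) hV hx hB h0
      (fun i j hi hj => (h2 i hi).trans (h2 j hj).symm) hns
    have hi' : 0 < μ i := hi
    have hval : ∀ r, r ≠ i → Function.update μ i 0 r = μ r := fun r hr =>
      Function.update_of_ne hr _ _
    refine hmin (Function.update μ i 0) ⟨fun r => ?_, fun r => ?_, fun r hr => ?_, ?_⟩ ?_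
    · by_cases hr : r = i
      · rw [hr, Function.update_self]
      · rw [hval r hr]
        exact h0 r
    · by_cases hr : r = i
      · rw [hr, Function.update_self]
        omega
      · rw [hval r hr]
        exact h1 r
    · by_cases hri : r = i
      · rw [hri, Function.update_self] at hr
        omega
      · rw [hval r hri] at hr ⊢
        exact h2 r hr
    · rw [← enhancedOrbit_eq_of_mem hmem]
      exact h3
    · change ∑ r ∈ Finset.range p.length, (Function.update μ i 0 r).toNat <
        ∑ r ∈ Finset.range p.length, (μ r).toNat
      refine Finset.sum_lt_sum (fun r _ => ?_) ⟨i, ?_, ?_⟩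
      · by_cases hr : r = i
        · rw [hr, Function.update_self]
          omega
        · rw [hval r hr]
      · have := h1 i
        exact Finset.mem_range.mpr ((p.lt_length_iff i).mpr (by omega))
      · rw [Function.update_self]
        omega
  · rw [Psi_eq (q := q) hV hx hB]
    exact (enhancedOrbit_eq_of_mem h3).symm

/-- Deleting rows from a minimal marking of one mark color leaves strict marks. Conversely the
missing signature is filled by arbitrary unmarked rows; the result is strict, hence minimal, and
deletion undoes the filling. -/
theorem isCharacteristicBipartition_iff [NeZero n] (hV : DirectSum.IsInternal V)
    (p : MarkedColoredPartition n) :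
    IsCharacteristicBipartition V (MarkedColoredPartitionClass.mk p) ↔
      p.signature ≤ spaceSignature V ∧ StrictMarks p.row ∧
        (∀ i, 0 < p.len i → 0 < p.mark i) ∧ ∀ i, p.len i = 0 → p.mark i = 0 := by
  constructor
  · rintro ⟨q, hmin, heq, hcol⟩
    have hpq : p.RowEquiv q.deleteUnmarked := Quotient.exact heq
    have hsig : p.signature = q.deleteUnmarked.signature := ColoredPartition.signature_eq hpq.shape
    have h0 : ∀ i, 0 ≤ q.deleteUnmarked.mark i := fun i => hmin.2.1 _
    have hinf : {i | i ∉ {i | 0 < q.len i ∧ q.mark i = 0}}.Infinite :=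
      (q.finite_support.subset fun _ (hi : _ ∈ {i | 0 < q.len i ∧ q.mark i = 0}) =>
        hi.1).infinite_compl
    -- Rows with a positive mark survive the deletion, so the color condition on the remaining rows
    -- covers all positive marks of q.
    have hnth : ∀ i, 0 < q.mark i → ∃ k, k < q.deleteUnmarked.length ∧
        Nat.nth (· ∉ {i | 0 < q.len i ∧ q.mark i = 0}) k = i := by
      intro i hi
      obtain ⟨k, hk⟩ : i ∈ Set.range (Nat.nth (· ∉ {i | 0 < q.len i ∧ q.mark i = 0})) := by
        rw [Nat.range_nth_of_infinite (p := (· ∉ {i | 0 < q.len i ∧ q.mark i = 0})) hinf]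
        exact fun h => hi.ne' h.2
      refine ⟨k, (ColoredPartition.lt_length_iff _ k).mpr ?_, hk⟩
      have h1 := q.mark_le i
      change 0 < q.len (Nat.nth (· ∉ {i | 0 < q.len i ∧ q.mark i = 0}) k)
      rw [hk]
      omega
    have hcol' : ∀ i j, 0 < q.mark i → 0 < q.mark j → q.markColor i = q.markColor j := by
      intro i j hi hj
      obtain ⟨k, hk, rfl⟩ := hnth i hi
      obtain ⟨l, hl, rfl⟩ := hnth j hj
      rcases lt_trichotomy k l with h | rfl | h
      · exact hcol k l h hl
      · rfl
      · exact (hcol l k h hk).symm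
    have hstrict := MarkedColoredPartition.strictMarks_deleteUnmarked
      (strictMarks_of_isMinimalMarking hV hmin hcol')
    obtain ⟨σ, hσ⟩ := (MarkedColoredPartition.rowEquiv_iff_exists _ _).mp ((MarkedColoredPartition.setoid n).symm hpq)
    have hrow : ∀ i, p.len i = q.deleteUnmarked.len (σ i) ∧
        p.mark i = q.deleteUnmarked.mark (σ i) := fun i =>
      ⟨congrArg (fun t => t.1) (congrFun hσ i), congrArg (fun t => t.2.2) (congrFun hσ i)⟩
    refine ⟨?_, ?_, fun i hi => ?_, fun i hi => ?_⟩
    · rw [hsig, ← hmin.1]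
      exact MarkedColoredPartition.signature_deleteRows_le _ _ _
    · rw [hσ]
      exact hstrict.comp σ.injective
    · rw [(hrow i).1] at hi
      rw [(hrow i).2]
      refine lt_of_le_of_ne (h0 _) fun h => ?_
      exact q.not_mem_deleteUnmarked _ ⟨hi, h.symm⟩
    · rw [(hrow i).1] at hi
      rw [(hrow i).2]
      have h1 := h0 (σ i)
      have h2 := q.deleteUnmarked.mark_le (σ i)
      omega
  · rintro ⟨hsig, hstrict, hpos, h0⟩
    obtain ⟨d, hd⟩ := ColoredPartition.exists_signature_eq (spaceSignature V - p.signature)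
    have hq := MarkedColoredPartition.strictMarks_union_unmarked hstrict d
    refine ⟨p.union d.unmarked, isMinimalMarking_of_strictMarks hV ?_ hq, ?_, ?_⟩
    · rw [MarkedColoredPartition.signature_union]
      change p.signature + d.signature = _
      rw [hd, add_tsub_cancel_of_le hsig]
    · exact Quotient.sound (p.rowEquiv_deleteUnmarked_union d hpos h0)
    · intro i j hij hj
      have hq' := MarkedColoredPartition.strictMarks_deleteUnmarked hq
      have hmark : ∀ k, k < (p.union d.unmarked).deleteUnmarked.length →
          0 < (p.union d.unmarked).deleteUnmarked.mark k := fun k hk =>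
        lt_of_le_of_ne (hq'.1 k) fun h => (p.union d.unmarked).not_mem_deleteUnmarked k
          ⟨(ColoredPartition.lt_length_iff _ k).mp hk, h.symm⟩
      exact (hq'.2 i j hij.ne (hmark i (hij.trans hj)) (hmark j hj)).1

/-- The orbit determines the rows. -/
theorem rowEquiv_of_Psi_eq (hV : DirectSum.IsInternal V) {p p' : MarkedColoredPartition n}
    {d d' : ColoredPartition n} (hsig : p.signature + d.signature = spaceSignature V)
    (hsig' : p'.signature + d'.signature = spaceSignature V)
    (hp : StrictMarks p.row) (hpos : ∀ i, 0 < p.len i → 0 < p.mark i)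
    (h0 : ∀ i, p.len i = 0 → p.mark i = 0)
    (hp' : StrictMarks p'.row) (hpos' : ∀ i, 0 < p'.len i → 0 < p'.mark i)
    (h0' : ∀ i, p'.len i = 0 → p'.mark i = 0)
    (h : Psi V (p.union d.unmarked) = Psi V (p'.union d'.unmarked)) :
    p.RowEquiv p' ∧ d.RowEquiv d' := by
  have hq := MarkedColoredPartition.strictMarks_union_unmarked hp d
  have hq' := MarkedColoredPartition.strictMarks_union_unmarked hp' d'
  have hs : (p.union d.unmarked).signature = spaceSignature V := by
    rw [MarkedColoredPartition.signature_union, ← hsig]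
    rfl
  have hs' : (p'.union d'.unmarked).signature = spaceSignature V := by
    rw [MarkedColoredPartition.signature_union, ← hsig']
    rfl
  obtain ⟨x, hx, B, hB⟩ := exists_isColoredJordanBasis_of_signature hV _ hs
  obtain ⟨y, hy, C, hC⟩ := exists_isColoredJordanBasis_of_signature hV _ hs'
  have hmem : (markVector B (p.union d.unmarked).mark, x) ∈ Psi V (p'.union d'.unmarked) := by
    rw [← h, Psi_eq hV hx hB]
    exact self_mem_enhancedOrbit V _
  rw [Psi_eq hV hy hC] at hmem
  obtain ⟨k, hk, hkeq⟩ := hmem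
  obtain ⟨hv, rfl⟩ := Prod.mk.inj hkeq
  -- Transporting the second basis by k puts both partitions over the same endomorphism and the same
  -- vector.
  have hD := hC.map hk
  simp only at hv
  rw [← markVector_map] at hv
  have hshape := (ColoredPartition.rowEquiv_iff _ _).mp (hB.rowEquiv hV hD)
  have hcount : ∀ t : ℕ × ZMod n × ℤ, 0 < t.2.2 →
      rowCount (p.union d.unmarked).row t = rowCount (p'.union d'.unmarked).row t := by
    intro t ht
    -- Equal rows are not strictly comparable, so a marked row has multiplicity 0 or 1 and its
    -- existence determines it.
    have hle : ∀ q : MarkedColoredPartition n, StrictMarks q.row → rowCount q.row t ≤ 1 := by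
      intro q hq
      refine rowCount_le_one fun i j hi hj => ?_
      by_contra hij
      have := (hq.2 i j hij (by rw [hi]; exact ht) (by rw [hj]; exact ht)).2
      rw [hi, hj] at this
      omega
    have hzero : rowCount (p.union d.unmarked).row t = 0 ↔
        rowCount (p'.union d'.unmarked).row t = 0 := by
      rw [rowCount_eq_zero_iff, rowCount_eq_zero_iff, ← not_exists, ← not_exists, not_iff_not]
      exact ⟨hB.exists_row_eq hV hD hq hq' hv ht, hD.exists_row_eq hV hB hq' hq hv.symm ht⟩
    by_cases hz : rowCount (p.union d.unmarked).row t = 0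
    · rw [hz, hzero.mp hz]
    · rw [le_antisymm (hle _ hq) (Order.one_le_iff_ne_zero.mpr hz),
        le_antisymm (hle _ hq') (Order.one_le_iff_ne_zero.mpr fun h => hz (hzero.mpr h))]
  have hpp : p.RowEquiv p' := by
    rw [MarkedColoredPartition.rowEquiv_iff]
    funext t
    rcases lt_trichotomy t.2.2 0 with ht | ht | ht
    · rw [(rowCount_eq_zero_iff _ _).mpr, (rowCount_eq_zero_iff _ _).mpr]
      · rintro i rfl
        exact absurd (hp'.1 i) (not_le.mpr ht)
      · rintro i rfl
        exact absurd (hp.1 i) (not_le.mpr ht)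
    · obtain ⟨l, c, m⟩ := t
      obtain rfl : m = 0 := ht
      rcases Nat.eq_zero_or_pos l with rfl | hl
      · rw [p.rowCount_row_zero h0, p'.rowCount_row_zero h0']
      · have hz : ∀ q : MarkedColoredPartition n, (∀ i, 0 < q.len i → 0 < q.mark i) →
            rowCount q.row (l, c, 0) = 0 := by
          intro q hqpos
          rw [rowCount_eq_zero_iff]
          intro i hi
          simp only [MarkedColoredPartition.row, Prod.mk.injEq] at hi
          have := hqpos i (by omega)
          omega
        rw [hz p hpos, hz p' hpos']
    · have := hcount t ht
      rwa [MarkedColoredPartition.rowCount_row_union, MarkedColoredPartition.rowCount_row_union,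
        MarkedColoredPartition.rowCount_unmarked _ _ ht.ne',
        MarkedColoredPartition.rowCount_unmarked _ _ ht.ne', add_zero, add_zero] at this
  refine ⟨hpp, ColoredPartition.rowEquiv_of_rowCount fun t ht => ?_⟩
  have h1 := congrFun hshape t
  have h2 := congrFun ((ColoredPartition.rowEquiv_iff _ _).mp hpp.shape) t
  rw [MarkedColoredPartition.rowCount_shape_union, MarkedColoredPartition.rowCount_shape_union,
    h2] at h1
  -- Nonempty rows have finite multiplicity, so those of p' cancel from the common shape.
  exact (ENat.add_right_injective_of_ne_top (p'.rowCount_row_lt_top ht).ne) h1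

end Minimal

/-! ### The parametrization of enhanced orbits. -/

theorem mainTheorem9 {n : ℕ} [NeZero n] {F W : Type*} [Field F] [AddCommGroup W] [Module F W]
    [FiniteDimensional F W] (V : ZMod n → Submodule F W) (hV : DirectSum.IsInternal V) :
    Set.BijOn
      (fun cd : MarkedColoredPartitionClass n × ColoredPartitionClass n =>
        PsiClass V (cd.1.union cd.2.toMarked))
      {cd | cd.1.signature + cd.2.signature = spaceSignature V ∧
        IsCharacteristicBipartition V cd.1}
      (enhancedOrbits V) ∧
    ∀ p : MarkedColoredPartition n,
      IsCharacteristicBipartition V (MarkedColoredPartitionClass.mk p) ↔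
        p.signature ≤ spaceSignature V ∧
        (∀ i, i < p.length → 0 < p.mark i) ∧
        (∀ i, p.length ≤ i → p.mark i = 0) ∧
        (∀ i j, i < j → j < p.length → p.markColor i = p.markColor j ∧
          p.mark j < p.mark i ∧ p.len j - p.mark j < p.len i - p.mark i) := by
  refine ⟨⟨?_, ?_, ?_⟩, fun p => ?_⟩
  · rintro ⟨c, d⟩ ⟨hsig, hchar⟩
    induction c using Quotient.inductionOn with | _ p
    induction d using Quotient.inductionOn with | _ d
    obtain ⟨-, hp, hpos, h0⟩ := (isCharacteristicBipartition_iff hV p).mp hchar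
    have hq := MarkedColoredPartition.strictMarks_union_unmarked hp d
    have hs : (p.union d.unmarked).signature = spaceSignature V := by
      rw [MarkedColoredPartition.signature_union]
      exact hsig
    obtain ⟨x, hx, B, hB⟩ := exists_isColoredJordanBasis_of_signature hV _ hs
    refine ⟨markVector B (p.union d.unmarked).mark, x, ?_, hx, Psi_eq hV hx hB⟩
    by_cases h : ∃ i, 0 < (p.union d.unmarked).mark i
    · obtain ⟨i, hi⟩ := h
      exact ⟨_, hB.strictMarks_mem hq hi⟩
    -- Without positive marks the vector is 0, which lies in every V m; the color 0 is an arbitrary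
    -- choice.
    · exact ⟨0, hB.markVector_mem fun i hi => absurd ⟨i, hi⟩ h⟩
  · rintro ⟨c, d⟩ ⟨hsig, hchar⟩ ⟨c', d'⟩ ⟨hsig', hchar'⟩ heq
    induction c using Quotient.inductionOn with | _ p
    induction d using Quotient.inductionOn with | _ d
    induction c' using Quotient.inductionOn with | _ p'
    induction d' using Quotient.inductionOn with | _ d'
    obtain ⟨-, hp, hpos, h0⟩ := (isCharacteristicBipartition_iff hV p).mp hchar
    obtain ⟨-, hp', hpos', h0'⟩ := (isCharacteristicBipartition_iff hV p').mp hchar'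
    obtain ⟨h1, h2⟩ := rowEquiv_of_Psi_eq hV hsig hsig' hp hpos h0 hp' hpos' h0' heq
    exact Prod.ext (Quotient.sound h1) (Quotient.sound h2)
  · rintro _ ⟨v, x, ⟨m, hv⟩, hx, rfl⟩
    obtain ⟨q, hsig, hq, hPsi⟩ := exists_strictMarks hV hx hv
    have h0 : ∀ i, q.len i = 0 → q.mark i = 0 := fun i hi => by
      have h1 := q.mark_le i
      have h2 : 0 ≤ q.mark i := hq.1 i
      omega
    have hequiv := q.union_unmarkedPart_rowEquiv h0
    have hsum : q.deleteUnmarked.signature + q.unmarkedPart.signature = spaceSignature V := by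
      rw [← hsig, ← ColoredPartition.signature_eq hequiv.shape,
        MarkedColoredPartition.signature_union]
      rfl
    refine ⟨(MarkedColoredPartitionClass.mk q.deleteUnmarked, Quotient.mk _ q.unmarkedPart),
      ⟨hsum, ?_⟩, ?_⟩
    · have hq' := MarkedColoredPartition.strictMarks_deleteUnmarked hq
      refine (isCharacteristicBipartition_iff hV _).mpr ⟨?_, hq', fun i hi => ?_, fun i hi => ?_⟩
      · rw [← hsum]
        exact le_self_add
      · exact lt_of_le_of_ne (hq'.1 i) fun h => q.not_mem_deleteUnmarked i ⟨hi, h.symm⟩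
      · exact h0 _ hi
    · rw [← hPsi]
      exact (Psi_subset V hequiv).antisymm (Psi_subset V ((MarkedColoredPartition.setoid n).symm hequiv))
  · rw [isCharacteristicBipartition_iff hV, MarkedColoredPartition.strictMarks_iff]
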